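/- Let $p,q,r\in(0,\infty)$. For $b\in(0,\infty]$ let $k$ be a positive continuous function on $(0,b)$ and let $\beta,\gamma,\mu$ be nonnegative continuous (that is, every one-point set has measure zero) Borel measures on $(0,b)$. Put $$\omega_{kp}(t)=\Big(\int_{(0,t)}k^p\,d\beta\Big)^{1/p},\qquad t\in(0,b),$$ and assume $\beta\in N_p(k)$, that is, $\omega_{kp}$ is positive, finite and continuous on $(0,b)$, $\omega_{kp}(0+)=0$ and $\omega_{kp}(b-0)=\infty$. Let $\Omega_k$ be the cone of the left-continuous functions $f:(0,b)\to[0,\infty)$ in $L_p(\beta)$ for which $f/k$ is nonincreasing. For the Hardy-type operator $(A_{r\mu}f)(t)=\big(\int_{(0,t]}f^r\,d\mu\big)^{1/r}$ put $$H_{\Omega_k}=\sup_{f\in\Omega_k}\Big(\int_{(0,b)}(A_{r\mu}f)^q\,d\gamma\Big)^{1/q}\Big(\int_{(0,b)}f^p\,d\beta\Big)^{-1/p}.$$ Define $\Psi_r(\tau)=\big(\int_{(0,\tau]}k^r\,d\mu\big)^{1/r}$, $W_q(t)=\gamma((t,b))^{1/q}$ and $$\mathfrak J_{pqr}=\sup_{t\in(0,b)}\Big(\int_{(0,b)}\Psi_r(\min\{t,\tau\})^q\,d\gamma(\tau)\Big)^{1/q}\omega_{kp}(t)^{-1}.$$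 If $p\le r$, put $V_{pr}(t)=\sup_{\tau\in(0,t]}\Psi_r(\tau)\,\omega_{kp}(\tau)^{-1}$; if $p>r$, put, with $\sigma=\frac{pr}{p-r}$, $$V_{pr}(t)=\Big\{\int_{(0,t]}\Psi_r^{\sigma}\,\big(-d[\omega_{kp}^{-\sigma}]\big)+\big[\Psi_r(t)\,\omega_{kp}(t)^{-1}\big]^{\sigma}\Big\}^{1/\sigma}.$$ If $p\le q$, put $$E_{pqr}=\sup_{t\in(0,b)}\Big(\int_{(0,t]}\Psi_r^q\,d\gamma\Big)^{1/q}\omega_{kp}(t)^{-1},\qquad F_{pqr}=\sup_{t\in(0,b)}V_{pr}(t)\,W_q(t);$$ if $p>q$, put, with $s=\frac{pq}{p-q}$, $$E_{pqr}=\Big\{\int_{(0,b)}\Big(\int_{(0,t]}\Psi_r^q\,d\gamma\Big)^{s/q}\big(-d[\omega_{kp}(t)^{-s}]\big)\Big\}^{1/s},\qquad F_{pqr}=\Big\{\int_{(0,b)}V_{pr}(t)^s\,\big(-d[W_q(t)^s]\big)\Big\}^{1/s}.$$ Here $-d[w]$ is the Lebesgue–Stieltjes measure on $(0,b)$ of the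 nonincreasing right-continuous function $w$ (with infinite mass on each nonempty set on which $w=\infty$); all quantities take values in $[0,\infty]$, $0\cdot\infty=0$, and $f=0$ contributes $0$ to the supremum. Then: 1. If $p\le\min\{q,r\}$, then $H_{\Omega_k}=\mathfrak J_{pqr}$. 2. If $p>\min\{q,r\}$, then there is a constant $c\in[1,\infty)$ depending only on $p,q,r$ (not on $b,k,\beta,\gamma,\mu$) such that $$c^{-1}\big((E_{pqr})^r+(F_{pqr})^r\big)^{1/r}\le H_{\Omega_k}\le c\,\big((E_{pqr})^r+(F_{pqr})^r\big)^{1/r}.$$ -/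

import Mathlib

open Set Filter Topology MeasureTheory
open scoped ENNReal NNReal

noncomputable section

namespace HardyCone

/-- The interval `(0, b)`, `0 < b ≤ ∞`, as a subset of the real line. -/
def interval (b : EReal) : Set ℝ := {t : ℝ | 0 < t ∧ (t : EReal) < b}

/-- The interval `(0, b)` as a type. For `t : J b`, the sets `Iic t`, `Iio t`, `Ioi t` are the
intervals `(0, t]`, `(0, t)`, `(t, b)`; a measure on `J b` is a Borel measure on `(0, b)`. -/
abbrev J (b : EReal) : Type := ↥(interval b)

instance ordConnected_interval (b : EReal) : OrdConnected (interval b) :=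
  ⟨fun _ hx _ hy _ hz =>
    ⟨lt_of_lt_of_le hx.1 hz.1, lt_of_le_of_lt (EReal.coe_le_coe_iff.2 hz.2) hy.2⟩⟩

instance compactIccSpace_J (b : EReal) : CompactIccSpace (J b) where
  isCompact_Icc := by
    intro x y
    rw [Subtype.isCompact_iff]
    have h : ((↑) : J b → ℝ) '' Icc x y = Icc (x : ℝ) (y : ℝ) := by
      ext z
      constructor
      · rintro ⟨u, hu, rfl⟩
        exact hu
      · intro hz
        exact ⟨⟨z, (ordConnected_interval b).out x.2 y.2 hz⟩, hz, rfl⟩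
    rw [h]
    exact isCompact_Icc

variable {b : EReal}

/-- The Lebesgue–Stieltjes measure `-dw` on `(0, b)` of a bounded nonincreasing function `w`;
if `w` is right-continuous, it gives the interval `(x, y]` the mass `w x - w y`
(and it is `0` by convention if `w` is not nonincreasing). -/
def stieltjesBdd (w : J b → ℝ) : Measure (J b) :=
  open Classical in
  if hw : Antitone w then (Monotone.stieltjesFunction (f := fun t => -w t) hw.neg).measure else 0

/-- The Lebesgue–Stieltjes measure `-dw` on `(0, b)` of a nonincreasing right-continuous function
`w` with values in `[0, ∞]`: the sum over `N` of the measures of the bounded slices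
`min (w - N) 1` of `w`; a nonempty set on which `w` is identically `∞` has infinite mass. If `w` is
finite everywhere, this is the usual measure with `(-dw) (x, y] = w x - w y`. -/
def negStieltjes (w : J b → ℝ≥0∞) : Measure (J b) :=
  Measure.sum (fun N : ℕ => stieltjesBdd fun t => (min (w t - N) 1).toReal) +
    (⊤ : Measure (J b)).restrict {t | w t = ∞}

/-- `ω_{kp}(t) = (∫_{(0,t)} k^p dβ)^{1/p}`. -/
def omega (p : ℝ) (k : J b → ℝ) (β : Measure (J b)) (t : J b) : ℝ≥0∞ :=
  (∫⁻ τ in Iio t, ENNReal.ofReal (k τ) ^ p ∂β) ^ (1 / p)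

/-- The class `N_p(k)`: `ω_{kp}` is positive, finite and continuous on `(0, b)`, with
`ω_{kp}(0+) = 0` and `ω_{kp}(b-) = ∞`. -/
structure MemN (p : ℝ) (k : J b → ℝ) (β : Measure (J b)) : Prop where
  pos : ∀ t, 0 < omega p k β t
  lt_top : ∀ t, omega p k β t < ∞
  cont : Continuous (omega p k β)
  zero : Tendsto (omega p k β) atBot (𝓝 0)
  top : Tendsto (omega p k β) atTop (𝓝 ∞)

/-- The cone `Ω_k` in `L_p(β)`: the nonnegative left-continuous functions `f` in `L_p(β)` for which
`f / k` is nonincreasing. -/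
def cone (p : ℝ) (k : J b → ℝ) (β : Measure (J b)) : Set (J b → ℝ) :=
  {f | (∀ t, 0 ≤ f t) ∧ (Antitone fun t => f t / k t) ∧
    (∀ t, ContinuousWithinAt f (Iic t) t) ∧ ∫⁻ t, ENNReal.ofReal (f t) ^ p ∂β < ∞}

/-- The Hardy-type operator `A_{rμ} f (t) = (∫_{(0,t]} f^r dμ)^{1/r}`. -/
def hardy (r : ℝ) (μ : Measure (J b)) (f : J b → ℝ) (t : J b) : ℝ≥0∞ :=
  (∫⁻ τ in Iic t, ENNReal.ofReal (f τ) ^ r ∂μ) ^ (1 / r)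

/-- The norm `H_{Ω_k}(A_{rμ})` of the restriction of `A_{rμ}` to `Ω_k`, as an operator from
`L_p(β)` to `L_q(γ)`. The function `f = 0` contributes `0 * ∞ = 0`. -/
def coneNorm (p q r : ℝ) (k : J b → ℝ) (β γ μ : Measure (J b)) : ℝ≥0∞ :=
  ⨆ f ∈ cone p k β,
    (∫⁻ t, hardy r μ f t ^ q ∂γ) ^ (1 / q) * (∫⁻ t, ENNReal.ofReal (f t) ^ p ∂β) ^ (-(1 / p))

/-- `Ψ_r(τ) = (∫_{(0,τ]} k^r dμ)^{1/r}`. -/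
def Psi (r : ℝ) (k : J b → ℝ) (μ : Measure (J b)) (τ : J b) : ℝ≥0∞ :=
  (∫⁻ x in Iic τ, ENNReal.ofReal (k x) ^ r ∂μ) ^ (1 / r)

/-- `𝔍_{pqr} = sup_t (∫_{(0,b)} Ψ_r(min{t,τ})^q dγ(τ))^{1/q} ω_{kp}(t)^{-1}`. -/
def constJ (p q r : ℝ) (k : J b → ℝ) (β γ μ : Measure (J b)) : ℝ≥0∞ :=
  ⨆ t : J b, (∫⁻ τ, Psi r k μ (min t τ) ^ q ∂γ) ^ (1 / q) * (omega p k β t)⁻¹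

/-- `V_{pr}(t)`: for `p ≤ r` it is `sup_{τ ∈ (0,t]} Ψ_r(τ) ω_{kp}(τ)^{-1}`; for `p > r`, with
`σ = pr/(p-r)`, it is
`(∫_{(0,t]} Ψ_r^σ (-d[ω_{kp}^{-σ}]) + [Ψ_r(t) ω_{kp}(t)^{-1}]^σ)^{1/σ}`. -/
def V (p r : ℝ) (k : J b → ℝ) (β μ : Measure (J b)) (t : J b) : ℝ≥0∞ :=
  if p ≤ r then ⨆ τ ∈ Iic t, Psi r k μ τ * (omega p k β τ)⁻¹
  else
    let σ : ℝ := p * r / (p - r)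
    ((∫⁻ τ in Iic t, Psi r k μ τ ^ σ ∂(negStieltjes fun x => omega p k β x ^ (-σ))) +
      (Psi r k μ t * (omega p k β t)⁻¹) ^ σ) ^ (1 / σ)

/-- `W_q(t) = γ((t,b))^{1/q}`. -/
def W (q : ℝ) (γ : Measure (J b)) (t : J b) : ℝ≥0∞ :=
  γ (Ioi t) ^ (1 / q)

/-- `E_{pqr}`: for `p ≤ q` it is `sup_t (∫_{(0,t]} Ψ_r^q dγ)^{1/q} ω_{kp}(t)^{-1}`; for `p > q`,
with `s = pq/(p-q)`, it is
`(∫_{(0,b)} (∫_{(0,t]} Ψ_r^q dγ)^{s/q} (-d[ω_{kp}(t)^{-s}]))^{1/s}`. -/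
def constE (p q r : ℝ) (k : J b → ℝ) (β γ μ : Measure (J b)) : ℝ≥0∞ :=
  if p ≤ q then
    ⨆ t : J b, (∫⁻ τ in Iic t, Psi r k μ τ ^ q ∂γ) ^ (1 / q) * (omega p k β t)⁻¹
  else
    let s : ℝ := p * q / (p - q)
    (∫⁻ t, (∫⁻ τ in Iic t, Psi r k μ τ ^ q ∂γ) ^ (s / q)
      ∂(negStieltjes fun x => omega p k β x ^ (-s))) ^ (1 / s)

/-- `F_{pqr}`: for `p ≤ q` it is `sup_t V_{pr}(t) W_q(t)`; for `p > q`, with `s = pq/(p-q)`, it is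
`(∫_{(0,b)} V_{pr}(t)^s (-d[W_q(t)^s]))^{1/s}`. -/
def constF (p q r : ℝ) (k : J b → ℝ) (β γ μ : Measure (J b)) : ℝ≥0∞ :=
  if p ≤ q then ⨆ t : J b, V p r k β μ t * W q γ t
  else
    let s : ℝ := p * q / (p - q)
    (∫⁻ t, V p r k β μ t ^ s ∂(negStieltjes fun x => W q γ x ^ s)) ^ (1 / s)

end HardyCone

end

noncomputable section

namespace HardyCone

variable {b : EReal}

/-! Put `g = f / k`, `dB = k^p dβ`, `dN = k^r dμ`. The cone becomes a class of nonincreasing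
functions, `ω^p` is the distribution function of `B`, and the question is the best `H` in `(∫
(∫_{(0,t]} g^r dN)^{q/r} dγ)^{1/q} ≤ H (∫ g^p dB)^{1/p}`.

If `p ≤ min q r`, the `p`-th power of the left side is the mixed `L_{q/p}(L_{r/p})` norm of `g^p`. A
nonincreasing `g^p` is a superposition of indicators of initial intervals, so Minkowski's
inequality, applied twice, reduces everything to these indicators without loss, and on them the best
constant is `𝔍` (`coneNorm_le_constJ`).

In general the building block is the embedding of nonincreasing functions from `L_p(B)` into
`L_r(U)`. Its norm is comparable to `embConst p r ω U` (`exists_lintegral_rpow_le_embConst`,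
`exists_embConst_le`), because sampling at points with `ω (x j) = 2 ^ j` turns it into a diagonal
operator from `ℓ^p` to `ℓ^r`. Both constants of the theorem are of this kind: `E` is `embConst` for
the measure `Ψ_r^q dγ` with target exponent `q`, and `V(t)` is `embConst` for `N` restricted to
`(0,t]`. The constant `F` is comparable to `levelConst`, the multiplier norm of `2^k γ{V >
2^k}^{1/q}`.

Sufficiency (`exists_hardy_le`): with `m = min p r`, split `g(x)^m`, `x ≤ t`, into `g(t)^m` and
layers indexed by the dyadic levels of `V`. The constant part produces `E`. Layer `l` lives where `V
≤ 2^(l+1)`, so the embedding bounds its inner integral by `2^l` times its norm; summing over the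
levels below that of `t` gives a geometric average, which a discrete Hardy inequality controls by
`F`. Necessity (`exists_levelConst_le`): take a nearly extremal function of the embedding for each
block `2^k < V ≤ 2^(k+1)` and superpose them with free coefficients. The blocks are disjoint, so the
Hardy inequality bounds a multiplier from `ℓ^p` to `ℓ^q`. -/

/-! ### Geometric sums and powers in `[0, ∞]` -/

theorem tsum_two_rpow_neg_ne_top {δ : ℝ} (hδ : 0 < δ) :
    ∑' d : ℕ, (2 : ℝ≥0∞) ^ (-(d * δ)) ≠ ∞ := by
  have h : ∀ d : ℕ, (2 : ℝ≥0∞) ^ (-(d * δ)) = ((2 : ℝ≥0∞) ^ (-δ)) ^ d := by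
    intro d
    rw [← ENNReal.rpow_natCast, ← ENNReal.rpow_mul]
    congr 1; ring
  simp_rw [h]
  rw [ENNReal.tsum_geometric]
  refine ENNReal.inv_ne_top.2 ?_
  have : (2 : ℝ≥0∞) ^ (-δ) < 1 := ENNReal.rpow_lt_one_of_one_lt_of_neg (by norm_num) (by linarith)
  exact (tsub_pos_of_lt this).ne'

theorem two_rpow_add (x y : ℝ) : (2 : ℝ≥0∞) ^ (x + y) = 2 ^ x * 2 ^ y :=
  ENNReal.rpow_add x y (by norm_num) (by norm_num)

theorem two_rpow_ne_top (x : ℝ) : (2 : ℝ≥0∞) ^ x ≠ ∞ :=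
  ENNReal.rpow_ne_top_of_ne_zero (by norm_num) (by norm_num)

theorem two_rpow_ne_zero (x : ℝ) : (2 : ℝ≥0∞) ^ x ≠ 0 := by simp

theorem two_rpow_neg_mul_self (x : ℝ) : (2 : ℝ≥0∞) ^ (-x) * 2 ^ x = 1 := by
  rw [← two_rpow_add]; simp

theorem two_rpow_le_two_rpow {x y : ℝ} (h : x ≤ y) : (2 : ℝ≥0∞) ^ x ≤ 2 ^ y :=
  ENNReal.rpow_le_rpow_of_exponent_le (by norm_num) h

/-- A power of a sum is controlled by a geometrically weighted sum of powers. -/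
theorem exists_tsum_rpow_le_geometric {θ ε : ℝ} (hθ : 0 < θ) (hε : 0 < ε) :
    ∃ C : ℝ≥0∞, C ≠ ∞ ∧ ∀ y : ℕ → ℝ≥0∞,
      (∑' d, y d) ^ θ ≤ C * ∑' d : ℕ, 2 ^ (d * ε) * y d ^ θ := by
  refine ⟨(∑' d : ℕ, (2 : ℝ≥0∞) ^ (-(d * (ε / θ)))) ^ θ, ENNReal.rpow_ne_top_of_nonneg hθ.le
    (tsum_two_rpow_neg_ne_top (div_pos hε hθ)), fun y => ?_⟩
  set S := ∑' d : ℕ, (2 : ℝ≥0∞) ^ (d * ε) * y d ^ θ with hS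
  -- Each term is bounded through `S` alone and the bounds form a geometric series, so no
  -- distinction between `θ ≤ 1` and `θ > 1` is needed.
  have hy : ∀ d, y d ≤ 2 ^ (-(d * (ε / θ))) * S ^ (1 / θ) := by
    intro d
    have h1 : (2 : ℝ≥0∞) ^ (d * ε) * y d ^ θ ≤ S := ENNReal.le_tsum d
    have h2 := ENNReal.rpow_le_rpow h1 (by positivity : 0 ≤ 1 / θ)
    rw [ENNReal.mul_rpow_of_nonneg _ _ (by positivity), ← ENNReal.rpow_mul, ← ENNReal.rpow_mul,
      mul_one_div_cancel hθ.ne', ENNReal.rpow_one] at h2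
    calc y d = 2 ^ (-(d * (ε / θ))) * (2 ^ (d * ε * (1 / θ)) * y d) := by
          rw [← mul_assoc, show d * ε * (1 / θ) = d * (ε / θ) by ring, two_rpow_neg_mul_self,
            one_mul]
      _ ≤ _ := by gcongr
  calc (∑' d, y d) ^ θ ≤ (∑' d : ℕ, (2 : ℝ≥0∞) ^ (-(d * (ε / θ))) * S ^ (1 / θ)) ^ θ :=
        ENNReal.rpow_le_rpow (ENNReal.tsum_le_tsum hy) hθ.le
    _ = _ := by
        rw [ENNReal.tsum_mul_right, ENNReal.mul_rpow_of_nonneg _ _ hθ.le, ← ENNReal.rpow_mul,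
          one_div_mul_cancel hθ.ne', ENNReal.rpow_one]

theorem add_rpow_le_two_rpow_mul (x y : ℝ≥0∞) {θ : ℝ} (hθ : 0 ≤ θ) :
    (x + y) ^ θ ≤ 2 ^ θ * (x ^ θ + y ^ θ) := by
  have h : x + y ≤ 2 * max x y := by
    rw [two_mul]; exact add_le_add (le_max_left _ _) (le_max_right _ _)
  calc (x + y) ^ θ ≤ (2 * max x y) ^ θ := ENNReal.rpow_le_rpow h hθ
    _ = 2 ^ θ * max x y ^ θ := ENNReal.mul_rpow_of_nonneg _ _ hθ
    _ ≤ _ := by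
      gcongr
      rcases le_total x y with h | h
      · rw [max_eq_right h]; exact le_add_self
      · rw [max_eq_left h]; exact le_self_add

theorem tsum_rpow_le_rpow_tsum {ι : Type*} (x : ι → ℝ≥0∞) {θ : ℝ} (hθ : 1 ≤ θ) :
    ∑' i, x i ^ θ ≤ (∑' i, x i) ^ θ := by
  have h : ∀ y : ℝ≥0∞, y ^ θ = y * y ^ (θ - 1) := by
    intro y
    conv_lhs => rw [show θ = 1 + (θ - 1) by ring]
    rw [ENNReal.rpow_add_of_nonneg _ _ zero_le_one (by linarith), ENNReal.rpow_one]
  calc ∑' i, x i ^ θ ≤ ∑' i, x i * (∑' i, x i) ^ (θ - 1) := by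
        refine ENNReal.tsum_le_tsum fun i => ?_
        rw [h]
        gcongr
        · exact ENNReal.le_tsum i
    _ = _ := by rw [ENNReal.tsum_mul_right, ← h]

theorem tsum_mul_le_Lp_mul_Lq (f g : ℤ → ℝ≥0∞) {p q : ℝ} (h : p.HolderConjugate q) :
    ∑' i, f i * g i ≤ (∑' i, f i ^ p) ^ (1 / p) * (∑' i, g i ^ q) ^ (1 / q) := by
  have := ENNReal.lintegral_mul_le_Lp_mul_Lq (Measure.count (α := ℤ)) h
    (measurable_of_countable f).aemeasurable (measurable_of_countable g).aemeasurable
  simpa [lintegral_count] using this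

/-! ### Diagonal operators from `ℓ^p(ℤ)` to `ℓ^q(ℤ)` -/

/-- The norm of the multiplication by `c` as an operator from `ℓ^p(ℤ)` to `ℓ^q(ℤ)`. -/
def multNorm (p q : ℝ) (c : ℤ → ℝ≥0∞) : ℝ≥0∞ :=
  if p ≤ q then ⨆ k, c k else (∑' k, c k ^ (p * q / (p - q))) ^ (1 / (p * q / (p - q)))

theorem le_multNorm {p q : ℝ} (hp : 0 < p) (hq : 0 < q) (c : ℤ → ℝ≥0∞) (k : ℤ) :
    c k ≤ multNorm p q c := by
  unfold multNorm
  split_ifs with hpq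
  · exact le_iSup c k
  · have : 0 < p * q / (p - q) := div_pos (mul_pos hp hq) (by linarith)
    rw [one_div, ENNReal.le_rpow_inv_iff this]
    exact ENNReal.le_tsum (f := fun k => c k ^ (p * q / (p - q))) k

/-- If `p ≤ q`, this is the inclusion of `ℓ^p` in `ℓ^q`. If `p > q`, it is Hölder's inequality with
the conjugate exponents `p/(p-q)` and `p/q`. -/
theorem tsum_mul_rpow_le_multNorm {p q : ℝ} (hp : 0 < p) (hq : 0 < q) (c a : ℤ → ℝ≥0∞) :
    ∑' k, (c k * a k) ^ q ≤ multNorm p q c ^ q * (∑' k, a k ^ p) ^ (q / p) := by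
  simp_rw [ENNReal.mul_rpow_of_nonneg _ _ hq.le]
  by_cases hpq : p ≤ q
  · have h : ∀ k, a k ^ q = (a k ^ p) ^ (q / p) := by
      intro k
      rw [← ENNReal.rpow_mul, mul_div_cancel₀ _ hp.ne']
    calc ∑' k, c k ^ q * a k ^ q ≤ ∑' k, multNorm p q c ^ q * a k ^ q := by
          refine ENNReal.tsum_le_tsum fun k => ?_
          gcongr
          exact le_multNorm hp hq c k
      _ ≤ _ := by
          rw [ENNReal.tsum_mul_left]
          gcongr
          simp_rw [h]
          exact tsum_rpow_le_rpow_tsum _ ((one_le_div hp).2 hpq)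
  · have hpq' : 0 < p - q := by linarith
    have hs : 0 < p * q / (p - q) := div_pos (mul_pos hp hq) hpq'
    have hc : (p * q / (p - q) / q).HolderConjugate (p / q) := by
      refine Real.holderConjugate_iff.2 ⟨?_, ?_⟩
      · rw [lt_div_iff₀ hq, lt_div_iff₀ hpq']; nlinarith
      · field_simp; ring
    refine (tsum_mul_le_Lp_mul_Lq _ _ hc).trans_eq ?_
    simp only [multNorm, if_neg hpq, ← ENNReal.rpow_mul]
    congr 2
    · refine tsum_congr fun k => ?_
      congr 1; field_simp
    · field_simp
    · refine tsum_congr fun k => ?_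
      congr 1; field_simp
    · field_simp

/-- Unit vectors give the supremum; for `p > q` the extremal sequence of Hölder's inequality,
`c^(s/p)` normalised on a finite set, gives the `ℓ^s` norm. Finitely many finite coefficients
suffice, so the test functions built from them later stay finite and left-continuous. -/
theorem multNorm_le_of_finset {p q : ℝ} (hp : 0 < p) (hq : 0 < q) (c : ℤ → ℝ≥0∞) {H : ℝ≥0∞}
    (h : ∀ (S : Finset ℤ) (a : ℤ → ℝ≥0∞), (∀ k, a k ≠ ∞) → ∑ k ∈ S, a k ^ p ≤ 1 →
      ∑ k ∈ S, (c k * a k) ^ q ≤ H ^ q) : multNorm p q c ≤ H := by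
  have hc : ∀ k, c k ≤ H := by
    intro k
    have := h {k} (fun _ => 1) (by simp) (by simp)
    simpa [ENNReal.rpow_le_rpow_iff hq] using this
  by_cases hH : H = ∞
  · simp [hH]
  unfold multNorm
  split_ifs with hpq
  · exact iSup_le hc
  have hpq' : 0 < p - q := by linarith
  set s := p * q / (p - q) with hsdef
  have hs : 0 < s := div_pos (mul_pos hp hq) hpq'
  have hct : ∀ k, c k ≠ ∞ := fun k => ne_top_of_le_ne_top hH (hc k)
  rw [ENNReal.tsum_eq_iSup_sum, one_div, ENNReal.rpow_inv_le_iff hs]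
  refine iSup_le fun S => ?_
  set Z := ∑ k ∈ S, c k ^ s with hZ
  by_cases hZ0 : Z = 0
  · simp [hZ0]
  have hZt : Z ≠ ∞ := by
    rw [hZ]
    exact (ENNReal.sum_lt_top.2 fun k _ =>
      (ENNReal.rpow_ne_top_of_nonneg hs.le (hct k)).lt_top).ne
  have hsum := h S (fun k => c k ^ (s / p) * Z ^ (-(1 / p)))
    (fun k => ENNReal.mul_ne_top (ENNReal.rpow_ne_top_of_nonneg (by positivity) (hct k))
      (ENNReal.rpow_ne_top_of_ne_zero hZ0 hZt)) (by
      simp_rw [ENNReal.mul_rpow_of_nonneg _ _ hp.le, ← ENNReal.rpow_mul]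
      rw [← Finset.sum_mul, div_mul_cancel₀ _ hp.ne', ← hZ, neg_mul, one_div_mul_cancel hp.ne',
        ENNReal.rpow_neg_one, ENNReal.mul_inv_cancel hZ0 hZt])
  have hterm : ∀ k, (c k * (c k ^ (s / p) * Z ^ (-(1 / p)))) ^ q = c k ^ s * Z ^ (-(q / p)) := by
    intro k
    have h1 : c k * c k ^ (s / p) = c k ^ (1 + s / p) := by
      rw [ENNReal.rpow_add_of_nonneg _ _ zero_le_one (by positivity), ENNReal.rpow_one]
    rw [← mul_assoc, h1, ENNReal.mul_rpow_of_nonneg _ _ hq.le, ← ENNReal.rpow_mul,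
      ← ENNReal.rpow_mul]
    congr 2
    · rw [hsdef]; field_simp; ring
    · ring
  simp_rw [hterm] at hsum
  rw [← Finset.sum_mul, ← hZ] at hsum
  have h2 : Z * Z ^ (-(q / p)) = Z ^ (q / s) := by
    conv_lhs => rw [← ENNReal.rpow_one Z]
    rw [← ENNReal.rpow_mul, ← ENNReal.rpow_add _ _ hZ0 hZt]
    congr 1
    rw [hsdef]; field_simp; ring
  rw [h2] at hsum
  have h3 := ENNReal.rpow_le_rpow hsum (by positivity : 0 ≤ s / q)
  rw [← ENNReal.rpow_mul, ← ENNReal.rpow_mul, show q / s * (s / q) = 1 by field_simp,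
    show q * (s / q) = s by field_simp, ENNReal.rpow_one] at h3
  exact h3

/-- The norm of a multiplier is not increased essentially by a geometrically decaying average over
shifts. -/
theorem exists_multNorm_le_of_geometric {p q : ℝ} (hp : 0 < p) (hq : 0 < q) :
    ∃ C : ℝ≥0∞, C ≠ ∞ ∧ ∀ (e : ℕ → ℤ ≃ ℤ) (c y : ℤ → ℝ≥0∞),
      (∀ k, c k ^ q ≤ ∑' d : ℕ, 2 ^ (-(d * q)) * y (e d k) ^ q) →
        multNorm p q c ≤ C * multNorm p q y := by
  by_cases hpq : p ≤ q
  · refine ⟨(∑' d : ℕ, (2 : ℝ≥0∞) ^ (-(d * q))) ^ (1 / q),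
      ENNReal.rpow_ne_top_of_nonneg (by positivity) (tsum_two_rpow_neg_ne_top hq),
      fun e c y h => ?_⟩
    conv_lhs => rw [multNorm, if_pos hpq]
    refine iSup_le fun k => ?_
    have : c k ^ q ≤ (∑' d : ℕ, (2 : ℝ≥0∞) ^ (-(d * q))) * multNorm p q y ^ q := by
      refine (h k).trans ?_
      rw [← ENNReal.tsum_mul_right]
      gcongr with d
      exact le_multNorm hp hq y _
    have h2 := ENNReal.rpow_le_rpow this (by positivity : 0 ≤ 1 / q)
    rwa [ENNReal.mul_rpow_of_nonneg _ _ (by positivity), ← ENNReal.rpow_mul, ← ENNReal.rpow_mul,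
      mul_one_div_cancel hq.ne', ENNReal.rpow_one, ENNReal.rpow_one] at h2
  · have hpq' : 0 < p - q := by linarith
    set s := p * q / (p - q) with hsdef
    have hs : 0 < s := div_pos (mul_pos hp hq) hpq'
    -- The weight `2^(-dq)` becomes `2^(-ds)` after raising to the power `s/q`. Half of this decay
    -- pays for the power of the sum, the other half keeps the sum over `d` finite.
    obtain ⟨C, hC, hCy⟩ := exists_tsum_rpow_le_geometric (div_pos hs hq) (half_pos hs)
    refine ⟨(C * ∑' d : ℕ, (2 : ℝ≥0∞) ^ (-(d * (s / 2)))) ^ (1 / s),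
      ENNReal.rpow_ne_top_of_nonneg (by positivity)
        (ENNReal.mul_ne_top hC (tsum_two_rpow_neg_ne_top (half_pos hs))), fun e c y h => ?_⟩
    simp only [multNorm, if_neg hpq, ← hsdef]
    rw [← ENNReal.mul_rpow_of_nonneg _ _ (by positivity)]
    refine ENNReal.rpow_le_rpow ?_ (by positivity)
    have hk : ∀ k, c k ^ s ≤ C * ∑' d : ℕ, 2 ^ (-(d * (s / 2))) * y (e d k) ^ s := by
      intro k
      calc c k ^ s = (c k ^ q) ^ (s / q) := by
            rw [← ENNReal.rpow_mul, mul_div_cancel₀ _ hq.ne']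
        _ ≤ (∑' d : ℕ, 2 ^ (-(d * q)) * y (e d k) ^ q) ^ (s / q) :=
            ENNReal.rpow_le_rpow (h k) (by positivity)
        _ ≤ _ := hCy _
        _ = _ := by
            congr 1
            refine tsum_congr fun d => ?_
            rw [ENNReal.mul_rpow_of_nonneg _ _ (by positivity), ← ENNReal.rpow_mul,
              ← ENNReal.rpow_mul, ← mul_assoc, ← two_rpow_add, mul_div_cancel₀ _ hq.ne']
            congr 2
            field_simp; ring
    calc ∑' k, c k ^ s ≤ ∑' k, C * ∑' d : ℕ, 2 ^ (-(d * (s / 2))) * y (e d k) ^ s :=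
          ENNReal.tsum_le_tsum hk
      _ = C * ∑' d : ℕ, ∑' k, 2 ^ (-(d * (s / 2))) * y (e d k) ^ s := by
          rw [ENNReal.tsum_mul_left, ENNReal.tsum_comm]
      _ = _ := by
          rw [mul_assoc, ← ENNReal.tsum_mul_right]
          congr 1
          refine tsum_congr fun d => ?_
          rw [ENNReal.tsum_mul_left, (e d).tsum_eq (fun k => y k ^ s)]

/-- A discrete Hardy inequality. -/
theorem exists_tsum_geometric_le_multNorm {p q m : ℝ} (hp : 0 < p) (hq : 0 < q) (hm : 0 < m) :
    ∃ C : ℝ≥0∞, C ≠ ∞ ∧ ∀ c a : ℤ → ℝ≥0∞,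
      ∑' k, c k ^ q * (∑' d : ℕ, (2 ^ (-(d : ℝ)) * a (k - d)) ^ m) ^ (q / m) ≤
        C * multNorm p q c ^ q * (∑' k, a k ^ p) ^ (q / p) := by
  obtain ⟨C, hC, hCy⟩ := exists_tsum_rpow_le_geometric (div_pos hq hm) (half_pos hq)
  refine ⟨C * ∑' d : ℕ, (2 : ℝ≥0∞) ^ (-(d * (q / 2))),
    ENNReal.mul_ne_top hC (tsum_two_rpow_neg_ne_top (half_pos hq)), fun c a => ?_⟩
  have hk : ∀ k, (∑' d : ℕ, (2 ^ (-(d : ℝ)) * a (k - d)) ^ m) ^ (q / m) ≤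
      C * ∑' d : ℕ, 2 ^ (-(d * (q / 2))) * a (k - d) ^ q := by
    intro k
    refine (hCy _).trans_eq ?_
    congr 1
    refine tsum_congr fun d => ?_
    rw [← ENNReal.rpow_mul, mul_div_cancel₀ _ hm.ne', ENNReal.mul_rpow_of_nonneg _ _ hq.le,
      ← ENNReal.rpow_mul, ← mul_assoc, ← two_rpow_add]
    congr 2
    ring
  calc ∑' k, c k ^ q * (∑' d : ℕ, (2 ^ (-(d : ℝ)) * a (k - d)) ^ m) ^ (q / m)
      ≤ ∑' k, c k ^ q * (C * ∑' d : ℕ, 2 ^ (-(d * (q / 2))) * a (k - d) ^ q) := by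
        gcongr with k
        exact hk k
    _ = C * ∑' k, ∑' d : ℕ, 2 ^ (-(d * (q / 2))) * (c k * a (k - d)) ^ q := by
        rw [← ENNReal.tsum_mul_left]
        refine tsum_congr fun k => ?_
        rw [mul_left_comm, ← ENNReal.tsum_mul_left]
        congr 1
        refine tsum_congr fun d => ?_
        rw [ENNReal.mul_rpow_of_nonneg _ _ hq.le, mul_left_comm]
    _ = C * ∑' d : ℕ, 2 ^ (-(d * (q / 2))) * ∑' k, (c k * a (k - d)) ^ q := by
        rw [ENNReal.tsum_comm]
        simp_rw [ENNReal.tsum_mul_left]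
    -- For each fixed `d` this is the multiplier inequality applied to a shift of `a`, and shifts
    -- preserve the `ℓ^p` norm.
    _ ≤ C * ∑' d : ℕ, 2 ^ (-(d * (q / 2))) *
          (multNorm p q c ^ q * (∑' k, a k ^ p) ^ (q / p)) := by
        gcongr with d
        refine (tsum_mul_rpow_le_multNorm hp hq c _).trans_eq ?_
        congr 2
        exact (Equiv.subRight (d : ℤ)).tsum_eq (fun k => a k ^ p)
    _ = _ := by rw [ENNReal.tsum_mul_right, mul_assoc, mul_assoc]

/-! ### Order structure of `(0, b)` and measures of half-lines -/

instance noMaxOrder_J : NoMaxOrder (J b) where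
  exists_gt t := by
    obtain ⟨s, hs, hsb⟩ := EReal.lt_iff_exists_real_btwn.1 t.2.2
    have hts : (t : ℝ) < s := EReal.coe_lt_coe_iff.1 hs
    exact ⟨⟨s, t.2.1.trans hts, hsb⟩, hts⟩

instance noMinOrder_J : NoMinOrder (J b) where
  exists_lt t := by
    have ht : (0 : ℝ) < t := t.2.1
    have h : (t : ℝ) / 2 < t := by linarith
    exact ⟨⟨t / 2, by positivity, (EReal.coe_lt_coe_iff.2 h).trans t.2.2⟩, h⟩

instance preconnectedSpace_J : PreconnectedSpace (J b) :=
  Subtype.preconnectedSpace (ordConnected_interval b).isPreconnected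

theorem nonempty_J (hb : 0 < b) : Nonempty (J b) := by
  obtain ⟨s, hs, hsb⟩ := EReal.lt_iff_exists_real_btwn.1 hb
  exact ⟨⟨s, by exact_mod_cast hs, hsb⟩⟩

theorem exists_monotone_seq_of_isLowerSet {S : Set (J b)} (hS : IsLowerSet S) (hne : S.Nonempty) :
    ∃ x : ℕ → J b, Monotone x ∧ (∀ n, x n ∈ S) ∧ ∀ y ∈ S, ∃ n, y ≤ x n := by
  have := hS.ordConnected
  have := hne.to_subtype
  obtain ⟨x, hx, hxt⟩ := exists_seq_monotone_tendsto_atTop_atTop S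
  refine ⟨fun n => x n, fun i j h => hx h, fun n => (x n).2, fun y hy => ?_⟩
  exact (hxt.eventually_ge_atTop ⟨y, hy⟩).exists

theorem exists_antitone_seq_of_isUpperSet {S : Set (J b)} (hS : IsUpperSet S) (hne : S.Nonempty) :
    ∃ x : ℕ → J b, Antitone x ∧ (∀ n, x n ∈ S) ∧ ∀ y ∈ S, ∃ n, x n ≤ y := by
  have := hS.ordConnected
  have := hne.to_subtype
  obtain ⟨x, hx, hxt⟩ := exists_seq_antitone_tendsto_atTop_atBot S
  refine ⟨fun n => x n, fun i j h => hx h, fun n => (x n).2, fun y hy => ?_⟩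
  exact (hxt.eventually_le_atBot ⟨y, hy⟩).exists

/-- A lower set, whether it is `(0,t)`, `(0,t]` or all of `(0,b)`, is a countable increasing union
of intervals `(0,x]` with `x` in it; continuity from below does the rest. -/
theorem measure_le_of_isLowerSet (U : Measure (J b)) {S : Set (J b)} (hS : IsLowerSet S)
    {c : ℝ≥0∞} (h : ∀ x ∈ S, U (Iic x) ≤ c) : U S ≤ c := by
  rcases S.eq_empty_or_nonempty with rfl | hne
  · simp
  obtain ⟨x, hx, hxS, hxc⟩ := exists_monotone_seq_of_isLowerSet hS hne
  have hsub : S ⊆ ⋃ n, Iic (x n) := fun y hy => mem_iUnion.2 (hxc y hy)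
  refine (measure_mono hsub).trans ?_
  have hm : Monotone fun n => Iic (x n) := fun i j hij => Iic_subset_Iic.2 (hx hij)
  rw [hm.measure_iUnion]
  exact iSup_le fun n => h _ (hxS n)

theorem measure_le_of_isUpperSet (U : Measure (J b)) {S : Set (J b)} (hS : IsUpperSet S)
    {c : ℝ≥0∞} (h : ∀ x ∈ S, U (Ici x) ≤ c) : U S ≤ c := by
  rcases S.eq_empty_or_nonempty with rfl | hne
  · simp
  obtain ⟨x, hx, hxS, hxc⟩ := exists_antitone_seq_of_isUpperSet hS hne
  have hsub : S ⊆ ⋃ n, Ici (x n) := fun y hy => mem_iUnion.2 (hxc y hy)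
  refine (measure_mono hsub).trans ?_
  have hm : Monotone fun n => Ici (x n) := fun i j hij => Ici_subset_Ici.2 (hx hij)
  rw [hm.measure_iUnion]
  exact iSup_le fun n => h _ (hxS n)

theorem measure_le_of_isUpperSet_of_nullSingleton (U : Measure (J b)) [NullSingletonClass U]
    {S : Set (J b)} (hS : IsUpperSet S) {c : ℝ≥0∞} (h : ∀ x ∈ S, U (Ioi x) ≤ c) : U S ≤ c :=
  measure_le_of_isUpperSet U hS fun x hx => by
    rw [← measure_congr (Ioi_ae_eq_Ici (μ := U) (a := x))]
    exact h x hx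

/-- For measures that may have atoms. The measure `-d[W^s]` is one: even for continuous `γ` it has
an atom where `γ((t,b))` jumps from `∞` to a finite value. -/
theorem measure_le_of_isUpperSet_of_noMin (U : Measure (J b))
    {S : Set (J b)} (hS : IsUpperSet S) (hmin : ∀ x ∈ S, ∃ y ∈ S, y < x)
    {c : ℝ≥0∞} (h : ∀ x ∈ S, U (Ioi x) ≤ c) : U S ≤ c :=
  measure_le_of_isUpperSet U hS fun x hx => by
    obtain ⟨y, hy, hyx⟩ := hmin x hx
    exact (measure_mono (Ici_subset_Ioi.2 hyx)).trans (h y hy)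

/-! ### Tails of the Lebesgue–Stieltjes measures -/

/-- The first `n` slices add up to `min x n`. This recovers `w` from the bounded slices in
`negStieltjes`. -/
theorem tsum_min_tsub_one (x : ℝ≥0∞) : ∑' N : ℕ, min (x - N) 1 = x := by
  have h : ∀ n : ℕ, ∑ N ∈ Finset.range n, min (x - N) 1 = min x n := by
    intro n
    induction n with
    | zero => simp
    | succ n ih =>
      rw [Finset.sum_range_succ, ih]
      rcases le_total x n with hx | hx
      · have hx' : x ≤ (n + 1 : ℕ) := hx.trans (by push_cast; exact le_self_add)
        rw [tsub_eq_zero_of_le hx, min_eq_left hx, min_eq_left hx']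
        simp
      · obtain ⟨y, rfl⟩ := exists_add_of_le hx
        rw [ENNReal.add_sub_cancel_left (ENNReal.natCast_ne_top n), min_eq_right le_self_add,
          ← min_add_add_left]
        push_cast; rfl
  have h1 := ENNReal.tendsto_nat_tsum fun N : ℕ => min (x - N) 1
  simp_rw [h] at h1
  have h2 : Tendsto (fun n : ℕ => min x (n : ℝ≥0∞)) atTop (𝓝 (min x ∞)) :=
    tendsto_const_nhds.min ENNReal.tendsto_nat_nhds_top
  rw [min_eq_left le_top] at h2
  exact tendsto_nhds_unique h1 h2

theorem stieltjesBdd_Ioi {u : J b → ℝ} (hu : Antitone u)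
    (hc : ∀ t, ContinuousWithinAt u (Ioi t) t) {l : ℝ} (hl : Tendsto u atTop (𝓝 l)) (t : J b) :
    stieltjesBdd u (Ioi t) = ENNReal.ofReal (u t - l) := by
  have h : ∀ x, (Monotone.stieltjesFunction (f := fun t => -u t) hu.neg) x = -u x := by
    intro x
    rw [Monotone.stieltjesFunction_eq]
    exact rightLim_eq_of_tendsto (hc x).neg
  rw [stieltjesBdd, dif_pos hu, StieltjesFunction.measure_Ioi (l := -l)]
  · rw [h]; congr 1; ring
  · have := hl.neg
    refine this.congr fun x => (h x).symm

theorem measure_top_apply {α : Type*} [MeasurableSpace α] {S : Set α} (hS : S.Nonempty) :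
    (⊤ : Measure α) S = ∞ := by
  obtain ⟨x, hx⟩ := hS
  have h : ((∞ : ℝ≥0∞) • Measure.dirac x) S ≤ (⊤ : Measure α) S :=
    (le_top : ((∞ : ℝ≥0∞) • Measure.dirac x) ≤ ⊤) S
  have h2 : (1 : ℝ≥0∞) ≤ Measure.dirac x S := by
    simpa [indicator_of_mem hx] using Measure.le_dirac_apply (a := x) (s := S)
  rw [Measure.smul_apply, smul_eq_mul, ENNReal.top_mul (by positivity)] at h
  exact top_le_iff.1 h

/-- Each slice is bounded, right-continuous and tends to `0` at `b`, so its measure of `(t,b)` is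
its value at `t`, and the slices sum to `w t`. The infinite part does not meet `(t,b)` unless `w t =
∞`, when the slices alone already give `∞`. -/
theorem negStieltjes_Ioi {w : J b → ℝ≥0∞} (hw : Antitone w)
    (hc : ∀ t, ContinuousWithinAt w (Ioi t) t) (h0 : Tendsto w atTop (𝓝 0)) (t : J b) :
    negStieltjes w (Ioi t) = w t := by
  have hN : ∀ N : ℕ, stieltjesBdd (fun t => (min (w t - N) 1).toReal) (Ioi t) =
      min (w t - N) 1 := by
    intro N
    have hfin : ∀ s, min (w s - N) 1 ≠ ∞ := fun s =>
      ne_top_of_le_ne_top ENNReal.one_ne_top (min_le_right _ _)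
    rw [stieltjesBdd_Ioi (l := 0)]
    · rw [sub_zero, ENNReal.ofReal_toReal (hfin t)]
    · intro x y hxy
      refine ENNReal.toReal_mono (hfin x) ?_
      exact min_le_min_right _ (tsub_le_tsub_right (hw hxy) _)
    · intro s
      refine (ENNReal.tendsto_toReal (hfin s)).comp (Tendsto.min ?_ tendsto_const_nhds)
      exact ENNReal.Tendsto.sub (hc s) tendsto_const_nhds (Or.inr (ENNReal.natCast_ne_top N))
    · have : Tendsto (fun s => min (w s - N) 1) atTop (𝓝 0) :=
        tendsto_of_tendsto_of_tendsto_of_le_of_le tendsto_const_nhds h0 (fun _ => zero_le)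
          fun s => (min_le_left _ _).trans tsub_le_self
      simpa [Function.comp_def] using (ENNReal.tendsto_toReal ENNReal.zero_ne_top).comp this
  rw [negStieltjes, Measure.add_apply, Measure.sum_apply _ measurableSet_Ioi]
  simp_rw [hN]
  rw [tsum_min_tsub_one]
  by_cases ht : w t = ∞
  · simp [ht]
  · have : Ioi t ∩ {s | w s = ∞} = ∅ := by
      ext s
      simp only [mem_inter_iff, mem_Ioi, mem_ofPred_eq, mem_empty_iff_false, iff_false, not_and]
      intro hs h
      exact ht (top_le_iff.1 (h ▸ hw hs.le))
    rw [Measure.restrict_apply measurableSet_Ioi, this, measure_empty, add_zero]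

theorem negStieltjes_Ioi_of_eq_top {w : J b → ℝ≥0∞} (hw : ∀ t, w t = ∞) (t : J b) :
    negStieltjes w (Ioi t) = ∞ := by
  have : {s | w s = ∞} = univ := by ext s; simp [hw]
  rw [negStieltjes, Measure.add_apply, this, Measure.restrict_univ,
    measure_top_apply nonempty_Ioi, add_top]

/-- If some tail of `γ` is finite, the tails tend to `0` at `b` and the general formula applies.
Otherwise `W` is identically `∞`, and the infinite part of `negStieltjes` supplies the value. -/
theorem negStieltjes_W_rpow_Ioi {q s : ℝ} (hq : 0 < q) (hs : 0 < s) (γ : Measure (J b)) (t : J b) :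
    negStieltjes (fun x => W q γ x ^ s) (Ioi t) = W q γ t ^ s := by
  have hW : ∀ t, W q γ t ^ s = γ (Ioi t) ^ (s / q) := fun t => by
    rw [W, ← ENNReal.rpow_mul]; congr 1; ring
  have hpos : 0 < s / q := div_pos hs hq
  simp_rw [hW]
  have hanti : Antitone fun x => γ (Ioi x) := fun x y h => measure_mono (Ioi_subset_Ioi h)
  by_cases hfin : ∃ x, γ (Ioi x) ≠ ∞
  · obtain ⟨x₀, hx₀⟩ := hfin
    refine negStieltjes_Ioi (w := fun x => γ (Ioi x) ^ (s / q))
      (fun x y h => ENNReal.rpow_le_rpow (hanti h) hpos.le) (fun x => ?_) ?_ t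
    · refine (ENNReal.continuous_rpow_const.tendsto _).comp ?_
      have h1 : Tendsto (fun y => γ (Ioi y)) (𝓝[>] x) (𝓝 (⨆ y ∈ Ioi x, γ (Ioi y))) := by
        have := hanti.tendsto_nhdsGT x
        rwa [sSup_image] at this
      have h2 : (⨆ y ∈ Ioi x, γ (Ioi y)) = γ (Ioi x) := by
        refine le_antisymm (iSup₂_le fun y hy => hanti (le_of_lt hy)) ?_
        refine measure_le_of_isUpperSet_of_noMin γ (isUpperSet_Ioi x)
          (fun y hy => exists_between hy) fun y hy => ?_
        exact le_iSup₂ (f := fun y (_ : y ∈ Ioi x) => γ (Ioi y)) y hy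
      rwa [h2] at h1
    · have h1 : Tendsto (fun y => γ (Ioi y)) atTop (𝓝 0) := by
        have h2 := tendsto_measure_iInter_atTop (μ := γ) (s := fun y : J b => Ioi y)
          (fun y => measurableSet_Ioi.nullMeasurableSet) (fun x y h => Ioi_subset_Ioi h)
          ⟨x₀, hx₀⟩
        have h3 : ⋂ y : J b, Ioi y = ∅ := by
          ext z
          simp only [mem_iInter, mem_Ioi, mem_empty_iff_false, iff_false, not_forall, not_lt]
          exact ⟨z, le_rfl⟩
        rwa [h3, measure_empty] at h2
      have := (ENNReal.continuous_rpow_const (y := s / q)).tendsto (0 : ℝ≥0∞) |>.comp h1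
      simpa [Function.comp_def, ENNReal.zero_rpow_of_pos hpos] using this
  · push Not at hfin
    rw [negStieltjes_Ioi_of_eq_top (fun x => by simp [hfin, hpos]), hfin, ENNReal.top_rpow_of_pos hpos]

/-! ### Weights and dyadic sequences -/

/-- `ω` is the `1/p`-th power of the distribution function of `B`, and maps `(0, b)` continuously
onto `(0, ∞)`. -/
structure IsWeight (p : ℝ) (B : Measure (J b)) (ω : J b → ℝ≥0∞) : Prop where
  measure_Iic : ∀ t, B (Iic t) = ω t ^ p
  pos : ∀ t, 0 < ω t
  lt_top : ∀ t, ω t < ∞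
  cont : Continuous ω
  zero : Tendsto ω atBot (𝓝 0)
  top : Tendsto ω atTop (𝓝 ∞)

namespace IsWeight

variable {p : ℝ} {B : Measure (J b)} {ω : J b → ℝ≥0∞}

theorem monotone (h : IsWeight p B ω) (hp : 0 < p) : Monotone ω := fun x y hxy => by
  rw [← ENNReal.rpow_le_rpow_iff hp, ← h.measure_Iic, ← h.measure_Iic]
  exact measure_mono (Iic_subset_Iic.2 hxy)

theorem negStieltjes_Ioi (h : IsWeight p B ω) (hp : 0 < p) {s : ℝ} (hs : 0 < s) (t : J b) :
    negStieltjes (fun x => ω x ^ (-s)) (Ioi t) = ω t ^ (-s) := by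
  refine HardyCone.negStieltjes_Ioi (w := fun x => ω x ^ (-s)) (fun x y hxy => ?_) (fun x => ?_) ?_ t
  · simp only [ENNReal.rpow_neg, ENNReal.inv_le_inv]
    exact ENNReal.rpow_le_rpow (h.monotone hp hxy) hs.le
  · exact (ENNReal.continuous_rpow_const.comp h.cont).continuousWithinAt
  · have := (ENNReal.continuous_rpow_const (y := -s)).tendsto ∞ |>.comp h.top
    simpa [Function.comp_def, ENNReal.top_rpow_of_neg (neg_lt_zero.2 hs)] using this

theorem exists_seq [Nonempty (J b)] (h : IsWeight p B ω) :
    ∃ x : ℤ → J b, ∀ j, ω (x j) = 2 ^ (j : ℝ) := by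
  have hr : ∀ j : ℤ, (2 : ℝ≥0∞) ^ (j : ℝ) ∈ range ω := fun j => by
    have h0 : (0 : ℝ≥0∞) < 2 ^ (j : ℝ) := bot_lt_iff_ne_bot.2 (two_rpow_ne_zero (j : ℝ))
    obtain ⟨y, hy⟩ := (h.zero.eventually_lt_const h0).exists
    obtain ⟨z, hz⟩ := (h.top.eventually_const_lt (lt_top_iff_ne_top.2 (two_rpow_ne_top (j : ℝ)))).exists
    exact mem_range_of_exists_le_of_exists_ge h.cont ⟨y, hy.le⟩ ⟨z, hz.le⟩
  choose x hx using hr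
  exact ⟨x, hx⟩

end IsWeight

theorem exists_two_rpow_lt_le {x : ℝ≥0∞} (h0 : x ≠ 0) (ht : x ≠ ∞) :
    ∃ k : ℤ, 2 ^ (k : ℝ) < x ∧ x ≤ 2 ^ ((k : ℝ) + 1) := by
  obtain ⟨k, hk⟩ := ENNReal.exists_mem_Ioc_zpow h0 ht (y := 2) (by norm_num) (by norm_num)
  refine ⟨k, ?_, ?_⟩
  · rw [ENNReal.rpow_intCast]; exact hk.1
  · have : ((k : ℝ) + 1) = ((k + 1 : ℤ) : ℝ) := by push_cast; rfl
    rw [this, ENNReal.rpow_intCast]; exact hk.2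

theorem two_rpow_lt_two_rpow {x y : ℝ} (h : x < y) : (2 : ℝ≥0∞) ^ x < 2 ^ y :=
  ENNReal.rpow_lt_rpow_of_exponent_lt (by norm_num) (by norm_num) h

/-- A sequence `x` along which the weight takes the values `2 ^ j`. -/
structure IsDyadic (ω : J b → ℝ≥0∞) (x : ℤ → J b) : Prop where
  eq : ∀ j, ω (x j) = 2 ^ (j : ℝ)

namespace IsDyadic

variable {p : ℝ} {B : Measure (J b)} {ω : J b → ℝ≥0∞} {x : ℤ → J b}

theorem strictMono (hx : IsDyadic ω x) (h : IsWeight p B ω) (hp : 0 < p) : StrictMono x := by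
  intro i j hij
  by_contra! hle
  have := h.monotone hp hle
  rw [hx.eq, hx.eq] at this
  exact absurd this (not_le.2 (two_rpow_lt_two_rpow (by exact_mod_cast hij)))

theorem iUnion_Ioc (hx : IsDyadic ω x) (h : IsWeight p B ω) (hp : 0 < p) :
    ⋃ j, Ioc (x j) (x (j + 1)) = univ := by
  refine eq_univ_of_forall fun t => mem_iUnion.2 ?_
  obtain ⟨k, hk, hk'⟩ := exists_two_rpow_lt_le (h.pos t).ne' (h.lt_top t).ne
  have hkt : x k < t := by
    by_contra! hle
    have := h.monotone hp hle
    rw [hx.eq] at this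
    exact absurd this (not_le.2 hk)
  by_cases ht : t ≤ x (k + 1)
  · exact ⟨k, hkt, ht⟩
  -- The weight may be constant on intervals: then `ω t = 2 ^ (k + 1)` is possible with `t` to the
  -- right of `x (k + 1)`, and `t` belongs to the next interval.
  · refine ⟨k + 1, not_le.1 ht, ?_⟩
    by_contra! hlt
    have := h.monotone hp hlt.le
    rw [hx.eq] at this
    refine absurd (this.trans hk') (not_le.2 (two_rpow_lt_two_rpow ?_))
    push_cast; linarith

theorem lintegral_eq_tsum (hx : IsDyadic ω x) (h : IsWeight p B ω) (hp : 0 < p)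
    (U : Measure (J b)) (f : J b → ℝ≥0∞) :
    ∫⁻ t, f t ∂U = ∑' j, ∫⁻ t in Ioc (x j) (x (j + 1)), f t ∂U := by
  rw [← lintegral_iUnion (fun _ => measurableSet_Ioc), hx.iUnion_Ioc h hp, Measure.restrict_univ]
  have := (hx.strictMono h hp).monotone.pairwise_disjoint_on_Ioc_succ
  simpa using this

theorem measure_Ioc (hx : IsDyadic ω x) (h : IsWeight p B ω) (hp : 0 < p) (j : ℤ) :
    B (Ioc (x j) (x (j + 1))) = 2 ^ (j * p) * (2 ^ p - 1) := by
  rw [← Iic_sdiff_Iic, measure_sdiff (Iic_subset_Iic.2 (hx.strictMono h hp (by simp)).le)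
    measurableSet_Iic.nullMeasurableSet, h.measure_Iic, h.measure_Iic, hx.eq, hx.eq,
    ENNReal.mul_sub (fun _ _ => two_rpow_ne_top _), ← ENNReal.rpow_mul, ← ENNReal.rpow_mul,
    ← two_rpow_add, mul_one]
  · congr 2; push_cast; ring
  · rw [h.measure_Iic]; exact ENNReal.rpow_ne_top_of_nonneg hp.le (h.lt_top _).ne

theorem negStieltjes_Ioc (hx : IsDyadic ω x) (h : IsWeight p B ω) (hp : 0 < p) {s : ℝ} (hs : 0 < s)
    (j : ℤ) : negStieltjes (fun t => ω t ^ (-s)) (Ioc (x j) (x (j + 1))) =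
      2 ^ (-(j * s)) * (1 - 2 ^ (-s)) := by
  rw [← Ioi_sdiff_Ioi, measure_sdiff (Ioi_subset_Ioi (hx.strictMono h hp (by simp)).le)
    measurableSet_Ioi.nullMeasurableSet, h.negStieltjes_Ioi hp hs, h.negStieltjes_Ioi hp hs, hx.eq,
    hx.eq, ENNReal.mul_sub (fun _ _ => two_rpow_ne_top _), ← ENNReal.rpow_mul, ← ENNReal.rpow_mul,
    ← two_rpow_add, mul_one]
  · congr 2
    · ring
    · push_cast; ring
  · rw [h.negStieltjes_Ioi hp hs]
    exact ENNReal.rpow_ne_top_of_ne_zero (h.pos _).ne' (h.lt_top _).ne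

end IsDyadic

/-! ### Test functions -/

/-- The nonincreasing, finite, left-continuous functions on `(0, b)`. -/
structure IsTest (P : J b → ℝ≥0∞) : Prop where
  anti : Antitone P
  ne_top : ∀ t, P t ≠ ∞
  leftCont : ∀ t, ContinuousWithinAt P (Iic t) t

namespace IsTest

theorem indicator_Iic (x : J b) : IsTest ((Iic x).indicator fun _ => (1 : ℝ≥0∞)) where
  anti s t hst := by
    by_cases ht : t ∈ Iic x
    · rw [indicator_of_mem ht, indicator_of_mem (show s ∈ Iic x from le_trans hst ht)]
    · rw [indicator_of_notMem ht]; exact zero_le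
  ne_top t := by
    by_cases ht : t ∈ Iic x <;> simp [ht]
  leftCont t := by
    rcases le_or_gt t x with ht | ht
    · refine continuousWithinAt_const.congr (f := fun _ => (1 : ℝ≥0∞)) (fun s hs => ?_) ?_
      · exact indicator_of_mem (show s ∈ Iic x from le_trans hs ht) _
      · exact indicator_of_mem (show t ∈ Iic x from ht) _
    · refine (continuousAt_const (y := (0 : ℝ≥0∞))).congr ?_ |>.continuousWithinAt
      filter_upwards [lt_mem_nhds ht] with s hs
      exact (indicator_of_notMem (show s ∉ Iic x from not_le.2 hs) _).symm

theorem zero : IsTest (fun _ : J b => (0 : ℝ≥0∞)) :=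
  ⟨fun _ _ _ => le_rfl, fun _ => ENNReal.zero_ne_top, fun _ => continuousWithinAt_const⟩

theorem add {P Q : J b → ℝ≥0∞} (hP : IsTest P) (hQ : IsTest Q) : IsTest fun t => P t + Q t :=
  ⟨fun _ _ h => add_le_add (hP.anti h) (hQ.anti h),
    fun t => ENNReal.add_ne_top.2 ⟨hP.ne_top t, hQ.ne_top t⟩,
    fun t => (hP.leftCont t).add (hQ.leftCont t)⟩

theorem const_mul {P : J b → ℝ≥0∞} (hP : IsTest P) {c : ℝ≥0∞} (hc : c ≠ ∞) :
    IsTest fun t => c * P t :=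
  ⟨fun _ _ h => mul_le_mul_right (hP.anti h) c, fun t => ENNReal.mul_ne_top hc (hP.ne_top t),
    fun t => ENNReal.Tendsto.const_mul (hP.leftCont t) (Or.inr hc)⟩

theorem sum {P : ℤ → J b → ℝ≥0∞} {c : ℤ → ℝ≥0∞} (S : Finset ℤ) (hP : ∀ k, IsTest (P k))
    (hc : ∀ k, c k ≠ ∞) : IsTest fun t => ∑ k ∈ S, c k * P k t := by
  classical
  induction S using Finset.induction_on with
  | empty => simpa using zero
  | insert k S hk ih => simpa [Finset.sum_insert hk] using ((hP k).const_mul (hc k)).add ih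

end IsTest

/-! ### Embeddings of nonincreasing functions -/

/-- The constant which characterizes the embedding of the nonincreasing functions in `L_p(B)` into
`L_r(U)`, where `ω ^ p` is the distribution function of `B`. -/
def embConst (p r : ℝ) (ω : J b → ℝ≥0∞) (U : Measure (J b)) : ℝ≥0∞ :=
  if p ≤ r then ⨆ t, U (Iic t) ^ (1 / r) * (ω t)⁻¹
  else (∫⁻ t, U (Iic t) ^ (p * r / (p - r) / r)
    ∂(negStieltjes fun x => ω x ^ (-(p * r / (p - r))))) ^ (1 / (p * r / (p - r)))

/-- The dyadic counterpart of `embConst`. -/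
def dyadicConst (p r : ℝ) (x : ℤ → J b) (U : Measure (J b)) : ℝ≥0∞ :=
  multNorm p r fun j => U (Iic (x (j + 1))) ^ (1 / r) * 2 ^ (-(j : ℝ))

theorem rpow_one_div_rpow (x : ℝ≥0∞) {r : ℝ} (hr : 0 < r) : (x ^ (1 / r)) ^ r = x := by
  rw [← ENNReal.rpow_mul, one_div_mul_cancel hr.ne', ENNReal.rpow_one]

theorem rpow_rpow_one_div (x : ℝ≥0∞) {r : ℝ} (hr : 0 < r) : (x ^ r) ^ (1 / r) = x := by
  rw [← ENNReal.rpow_mul, mul_one_div_cancel hr.ne', ENNReal.rpow_one]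

/-- For `p ≤ r`, take `t = x (j + 1)`. For `p > r`, on the next dyadic interval `(x (j+1), x (j+2)]`
one has `U(0,t] ≥ U(0, x (j+1)]`, and `-d[ω^(-s)]` has mass comparable to `2^(-js)` there; hence the
shift of the index by one. -/
theorem exists_dyadicConst_le {p r : ℝ} (hp : 0 < p) (hr : 0 < r) :
    ∃ C : ℝ≥0∞, C ≠ ∞ ∧ ∀ (b : EReal) (B : Measure (J b)) (ω : J b → ℝ≥0∞) (x : ℤ → J b)
      (U : Measure (J b)), IsWeight p B ω → IsDyadic ω x →
      dyadicConst p r x U ≤ C * embConst p r ω U := by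
  by_cases hpr : p ≤ r
  · refine ⟨2, by norm_num, fun b B ω x U hω hx => ?_⟩
    rw [dyadicConst, multNorm, if_pos hpr, embConst, if_pos hpr]
    refine iSup_le fun j => ?_
    have h2 : (2 : ℝ≥0∞) ^ (-(j : ℝ)) = 2 * (ω (x (j + 1)))⁻¹ := by
      rw [hx.eq, ← ENNReal.rpow_neg]
      nth_rewrite 2 [← ENNReal.rpow_one 2]
      rw [← two_rpow_add]; congr 1; push_cast; ring
    rw [h2, mul_left_comm]
    gcongr
    exact le_iSup (fun t => U (Iic t) ^ (1 / r) * (ω t)⁻¹) (x (j + 1))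
  · have hpr' : 0 < p - r := by linarith
    set s := p * r / (p - r) with hsdef
    have hs : 0 < s := div_pos (mul_pos hp hr) hpr'
    have h1 : (1 : ℝ≥0∞) - 2 ^ (-s) ≠ 0 :=
      (tsub_pos_of_lt (ENNReal.rpow_lt_one_of_one_lt_of_neg (by norm_num) (by linarith))).ne'
    have h1t : (1 : ℝ≥0∞) - 2 ^ (-s) ≠ ∞ := ENNReal.sub_ne_top ENNReal.one_ne_top
    refine ⟨(2 ^ s * (1 - 2 ^ (-s))⁻¹) ^ (1 / s), ENNReal.rpow_ne_top_of_nonneg (by positivity)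
      (ENNReal.mul_ne_top (two_rpow_ne_top _) (ENNReal.inv_ne_top.2 h1)),
      fun b B ω x U hω hx => ?_⟩
    simp only [dyadicConst, multNorm, if_neg hpr, embConst, ← hsdef]
    rw [← ENNReal.mul_rpow_of_nonneg _ _ (by positivity)]
    refine ENNReal.rpow_le_rpow ?_ (by positivity)
    rw [hx.lintegral_eq_tsum hω hp, ← (Equiv.addRight (1 : ℤ)).tsum_eq
      (fun j => ∫⁻ t in Ioc (x j) (x (j + 1)), U (Iic t) ^ (s / r)
        ∂(negStieltjes fun x => ω x ^ (-s))), ← ENNReal.tsum_mul_left]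
    refine ENNReal.tsum_le_tsum fun j => ?_
    simp only [Equiv.coe_addRight]
    have hint : U (Iic (x (j + 1))) ^ (s / r) * (2 ^ (-((j + 1 : ℤ) * s)) * (1 - 2 ^ (-s))) ≤
        ∫⁻ t in Ioc (x (j + 1)) (x (j + 1 + 1)), U (Iic t) ^ (s / r)
          ∂(negStieltjes fun x => ω x ^ (-s)) := by
      rw [← hx.negStieltjes_Ioc hω hp hs, ← setLIntegral_const]
      refine setLIntegral_mono' measurableSet_Ioc fun t ht => ?_
      gcongr
      exact ht.1.le
    calc (U (Iic (x (j + 1))) ^ (1 / r) * 2 ^ (-(j : ℝ))) ^ s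
        = U (Iic (x (j + 1))) ^ (s / r) * 2 ^ (-(j * s)) := by
          rw [ENNReal.mul_rpow_of_nonneg _ _ hs.le, ← ENNReal.rpow_mul, ← ENNReal.rpow_mul]
          congr 2
          · ring
          · ring
      _ = 2 ^ s * (1 - 2 ^ (-s))⁻¹ *
          (U (Iic (x (j + 1))) ^ (s / r) * (2 ^ (-((j + 1 : ℤ) * s)) * (1 - 2 ^ (-s)))) := by
          have : (2 : ℝ≥0∞) ^ (-(j * s)) = 2 ^ s * 2 ^ (-((j + 1 : ℤ) * s)) := by
            rw [← two_rpow_add]; congr 1; push_cast; ring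
          rw [this]
          calc _ = U (Iic (x (j + 1))) ^ (s / r) * (2 ^ s * 2 ^ (-((j + 1 : ℤ) * s))) *
                ((1 - 2 ^ (-s))⁻¹ * (1 - 2 ^ (-s))) := by
                rw [ENNReal.inv_mul_cancel h1 h1t, mul_one]
            _ = _ := by ring
      _ ≤ _ := by gcongr

/-- On `(x j, x (j+1)]` the mass `U(0,t]` is at most `U(0, x (j+1)]`, while `ω ≥ 2^j` and
`-d[ω^(-s)]` has mass at most `2^(-js)`. -/
theorem embConst_le_dyadicConst {p r : ℝ} (hp : 0 < p) (hr : 0 < r) {B : Measure (J b)}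
    {ω : J b → ℝ≥0∞} {x : ℤ → J b} (U : Measure (J b)) (hω : IsWeight p B ω)
    (hx : IsDyadic ω x) : embConst p r ω U ≤ dyadicConst p r x U := by
  by_cases hpr : p ≤ r
  · rw [dyadicConst, multNorm, if_pos hpr, embConst, if_pos hpr]
    refine iSup_le fun t => ?_
    obtain ⟨j, hj⟩ := mem_iUnion.1 ((hx.iUnion_Ioc hω hp).symm ▸ mem_univ t)
    refine le_trans ?_
      (le_iSup (fun j : ℤ => U (Iic (x (j + 1))) ^ (1 / r) * (2 : ℝ≥0∞) ^ (-(j : ℝ))) j)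
    rw [ENNReal.rpow_neg, ← hx.eq]
    gcongr
    · exact hj.2
    · exact hω.monotone hp hj.1.le
  · have hpr' : 0 < p - r := by linarith
    set s := p * r / (p - r) with hsdef
    have hs : 0 < s := div_pos (mul_pos hp hr) hpr'
    simp only [dyadicConst, multNorm, if_neg hpr, embConst, ← hsdef]
    refine ENNReal.rpow_le_rpow ?_ (by positivity)
    rw [hx.lintegral_eq_tsum hω hp]
    refine ENNReal.tsum_le_tsum fun j => ?_
    calc ∫⁻ t in Ioc (x j) (x (j + 1)), U (Iic t) ^ (s / r)
          ∂(negStieltjes fun x => ω x ^ (-s))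
        ≤ U (Iic (x (j + 1))) ^ (s / r) * (2 ^ (-(j * s)) * (1 - 2 ^ (-s))) := by
          rw [← hx.negStieltjes_Ioc hω hp hs, ← setLIntegral_const]
          refine setLIntegral_mono' measurableSet_Ioc fun t ht => ?_
          gcongr
          exact ht.2
      _ ≤ U (Iic (x (j + 1))) ^ (s / r) * (2 ^ (-(j * s)) * 1) := by
          gcongr
          exact tsub_le_self
      _ = _ := by
          rw [mul_one, ENNReal.mul_rpow_of_nonneg _ _ hs.le, ← ENNReal.rpow_mul,
            ← ENNReal.rpow_mul]
          congr 2
          · ring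
          · ring

/-- The embedding of nonincreasing functions: sufficiency. -/
theorem exists_lintegral_rpow_le_embConst {p r : ℝ} (hp : 0 < p) (hr : 0 < r) :
    ∃ C : ℝ≥0∞, C ≠ ∞ ∧ ∀ (b : EReal) [Nonempty (J b)] (B : Measure (J b)) (ω : J b → ℝ≥0∞)
      (U : Measure (J b)), IsWeight p B ω → ∀ g : J b → ℝ≥0∞, Antitone g →
      ∫⁻ t, g t ^ r ∂U ≤ C * embConst p r ω U ^ r * (∫⁻ t, g t ^ p ∂B) ^ (r / p) := by
  obtain ⟨C, hC, hCK⟩ := exists_dyadicConst_le hp hr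
  have h1 : (2 : ℝ≥0∞) ^ p - 1 ≠ 0 :=
    (tsub_pos_of_lt (ENNReal.one_lt_rpow (by norm_num) hp)).ne'
  have h1t : (2 : ℝ≥0∞) ^ p - 1 ≠ ∞ := ENNReal.sub_ne_top (two_rpow_ne_top _)
  set D : ℝ≥0∞ := 2 ^ p * (2 ^ p - 1)⁻¹ with hD
  have hDt : D ≠ ∞ := ENNReal.mul_ne_top (two_rpow_ne_top _) (ENNReal.inv_ne_top.2 h1)
  refine ⟨C ^ r * D ^ (r / p), ENNReal.mul_ne_top (ENNReal.rpow_ne_top_of_nonneg hr.le hC)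
    (ENNReal.rpow_ne_top_of_nonneg (by positivity) hDt), fun b _ B ω U hω g hg => ?_⟩
  obtain ⟨x, hx⟩ := hω.exists_seq
  replace hx : IsDyadic ω x := ⟨hx⟩
  -- On `(x j, x (j+1)]` the function `g` is at least `g (x (j+1))`, and `B` has mass `2^(jp) (2^p -
  -- 1)`; the constant `D` compares this with `2^((j+1)p)`.
  have hB : ∑' j : ℤ, (g (x j) * 2 ^ (j : ℝ)) ^ p ≤ D * ∫⁻ t, g t ^ p ∂B := by
    rw [hx.lintegral_eq_tsum hω hp, ← (Equiv.addRight (1 : ℤ)).tsum_eq, ← ENNReal.tsum_mul_left]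
    refine ENNReal.tsum_le_tsum fun j => ?_
    simp only [Equiv.coe_addRight]
    have hint : g (x (j + 1)) ^ p * (2 ^ (j * p) * (2 ^ p - 1)) ≤
        ∫⁻ t in Ioc (x j) (x (j + 1)), g t ^ p ∂B := by
      rw [← hx.measure_Ioc hω hp, ← setLIntegral_const]
      refine setLIntegral_mono' measurableSet_Ioc fun t ht => ?_
      gcongr
      exact hg ht.2
    calc (g (x (j + 1)) * 2 ^ ((j + 1 : ℤ) : ℝ)) ^ p
        = g (x (j + 1)) ^ p * (2 ^ p * 2 ^ (j * p)) := by
          rw [ENNReal.mul_rpow_of_nonneg _ _ hp.le, ← ENNReal.rpow_mul, ← two_rpow_add]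
          congr 2
          push_cast; ring
      _ = D * (g (x (j + 1)) ^ p * (2 ^ (j * p) * (2 ^ p - 1))) := by
          rw [hD]
          calc _ = g (x (j + 1)) ^ p * (2 ^ p * 2 ^ (j * p)) * ((2 ^ p - 1)⁻¹ * (2 ^ p - 1)) := by
                rw [ENNReal.inv_mul_cancel h1 h1t, mul_one]
            _ = _ := by ring
      _ ≤ _ := by gcongr
  calc ∫⁻ t, g t ^ r ∂U = ∑' j, ∫⁻ t in Ioc (x j) (x (j + 1)), g t ^ r ∂U :=
        hx.lintegral_eq_tsum hω hp _ _
    -- Here `g` is replaced by its value at the left endpoint, and the sum becomes the multiplier of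
    -- `dyadicConst` acting on the sequence `g (x j) 2^j`.
    _ ≤ ∑' j : ℤ, (U (Iic (x (j + 1))) ^ (1 / r) * 2 ^ (-(j : ℝ)) *
          (g (x j) * 2 ^ (j : ℝ))) ^ r := by
        refine ENNReal.tsum_le_tsum fun j => ?_
        calc ∫⁻ t in Ioc (x j) (x (j + 1)), g t ^ r ∂U
            ≤ g (x j) ^ r * U (Ioc (x j) (x (j + 1))) := by
              rw [← setLIntegral_const]
              refine setLIntegral_mono' measurableSet_Ioc fun t ht => ?_
              gcongr
              exact hg ht.1.le
          _ ≤ g (x j) ^ r * U (Iic (x (j + 1))) := by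
              gcongr
              exact Ioc_subset_Iic_self
          _ = (U (Iic (x (j + 1))) ^ (1 / r) * g (x j) *
                (2 ^ (-(j : ℝ)) * 2 ^ (j : ℝ))) ^ r := by
              rw [two_rpow_neg_mul_self, mul_one, ENNReal.mul_rpow_of_nonneg _ _ hr.le,
                rpow_one_div_rpow _ hr, mul_comm]
          _ = _ := by congr 1; ring
    _ ≤ dyadicConst p r x U ^ r * (∑' j : ℤ, (g (x j) * 2 ^ (j : ℝ)) ^ p) ^ (r / p) :=
        tsum_mul_rpow_le_multNorm hp hr _ _
    _ ≤ (C * embConst p r ω U) ^ r * (D * ∫⁻ t, g t ^ p ∂B) ^ (r / p) := by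
        gcongr
        exact hCK b B ω x U hω hx
    _ = _ := by
        rw [ENNReal.mul_rpow_of_nonneg _ _ hr.le, ENNReal.mul_rpow_of_nonneg _ _ (by positivity)]
        ring

/-- The embedding of nonincreasing functions: necessity. -/
theorem exists_embConst_le {p r : ℝ} (hp : 0 < p) (hr : 0 < r) :
    ∃ C : ℝ≥0∞, C ≠ ∞ ∧ ∀ (b : EReal) [Nonempty (J b)] (B : Measure (J b)) (ω : J b → ℝ≥0∞)
      (U : Measure (J b)), IsWeight p B ω → ∀ h : ℝ≥0∞,
      (∀ P : J b → ℝ≥0∞, IsTest P → ∫⁻ t, P t ∂B ≤ 1 → ∫⁻ t, P t ^ (r / p) ∂U ≤ h ^ r) →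
      embConst p r ω U ≤ C * h := by
  obtain ⟨C, hC, hCM⟩ := exists_multNorm_le_of_geometric hp hr
  refine ⟨C * 2, ENNReal.mul_ne_top hC (by norm_num), fun b _ B ω U hω h hh => ?_⟩
  obtain ⟨x, hx⟩ := hω.exists_seq
  replace hx : IsDyadic ω x := ⟨hx⟩
  have hmono := hx.strictMono hω hp
  -- Blocks replace initial intervals because they are disjoint, so contributions of different `j`
  -- can be added. The return to initial intervals costs a geometric average: block `j - d` enters
  -- with the factor `2^(-dr)`.
  set y : ℤ → ℝ≥0∞ := fun j => U (Ioc (x j) (x (j + 1))) ^ (1 / r) * 2 ^ (-(j : ℝ)) with hy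
  have hyr : ∀ j, y j ^ r = U (Ioc (x j) (x (j + 1))) * 2 ^ (-(j * r)) := fun j => by
    simp only [hy]
    rw [ENNReal.mul_rpow_of_nonneg _ _ hr.le, rpow_one_div_rpow _ hr, ← ENNReal.rpow_mul, neg_mul]
  refine (embConst_le_dyadicConst hp hr U hω hx).trans ?_
  rw [dyadicConst]
  have hgeo := hCM (fun d => Equiv.subRight (d : ℤ))
    (fun j => U (Iic (x (j + 1))) ^ (1 / r) * 2 ^ (-(j : ℝ))) y fun j => by
      have hsub : Iic (x (j + 1)) ⊆ ⋃ d : ℕ, Ioc (x (j - d)) (x (j - d + 1)) := by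
        intro t ht
        obtain ⟨k, hk⟩ := mem_iUnion.1 ((hx.iUnion_Ioc hω hp).symm ▸ mem_univ t)
        have hkj : k < j + 1 := hmono.lt_iff_lt.1 (hk.1.trans_le ht)
        refine mem_iUnion.2 ⟨(j - k).toNat, ?_⟩
        have : j - ((j - k).toNat : ℤ) = k := by omega
        rwa [this]
      rw [ENNReal.mul_rpow_of_nonneg _ _ hr.le, rpow_one_div_rpow _ hr, ← ENNReal.rpow_mul]
      calc U (Iic (x (j + 1))) * 2 ^ (-(j : ℝ) * r)
          ≤ (∑' d : ℕ, U (Ioc (x (j - d)) (x (j - d + 1)))) * 2 ^ (-(j : ℝ) * r) := by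
            gcongr
            exact (measure_mono hsub).trans (measure_iUnion_le _)
        _ = _ := by
            rw [← ENNReal.tsum_mul_right]
            refine tsum_congr fun d => ?_
            rw [Equiv.subRight_apply, hyr, mul_left_comm, ← two_rpow_add]
            congr 2
            push_cast; ring
  refine hgeo.trans ?_
  rw [mul_assoc]
  gcongr
  refine multNorm_le_of_finset hp hr y fun S a ha haS => ?_
  -- The indicator of `(0, x (j+1)]` has `B`-integral `2^((j+1)p)`, so the integral of `P` is
  -- exactly `∑ a_j^p`.
  set P : J b → ℝ≥0∞ := fun t => ∑ j ∈ S, (a j ^ p * 2 ^ (-((j + 1 : ℝ) * p))) *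
    (Iic (x (j + 1))).indicator (fun _ => (1 : ℝ≥0∞)) t with hP
  have hPtest : IsTest P := IsTest.sum S (fun j => IsTest.indicator_Iic _) fun j =>
    ENNReal.mul_ne_top (ENNReal.rpow_ne_top_of_nonneg hp.le (ha j)) (two_rpow_ne_top _)
  have hPint : ∫⁻ t, P t ∂B ≤ 1 := by
    rw [lintegral_finsetSum _ fun j _ =>
      (measurable_const.indicator measurableSet_Iic).const_mul _]
    refine le_trans (le_of_eq (Finset.sum_congr rfl fun j _ => ?_)) haS
    rw [lintegral_const_mul _ (measurable_const.indicator measurableSet_Iic),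
      lintegral_indicator_const measurableSet_Iic, hω.measure_Iic, hx.eq, one_mul,
      ← ENNReal.rpow_mul, mul_assoc, ← two_rpow_add]
    simp
  have hmain := hh P hPtest hPint
  -- On block `j` only the `j`-th term of `P` is kept; the factor `2^(-r)` comes from its
  -- normalisation at `x (j+1)` instead of `x j`.
  have hlow : ∑ j ∈ S, (y j * a j) ^ r * 2 ^ (-r) ≤ ∫⁻ t, P t ^ (r / p) ∂U := by
    rw [hx.lintegral_eq_tsum hω hp]
    refine le_trans ?_ (ENNReal.sum_le_tsum S)
    refine Finset.sum_le_sum fun j hj => ?_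
    have hPj : ∀ t ∈ Ioc (x j) (x (j + 1)),
        a j ^ r * 2 ^ (-((j + 1 : ℝ) * r)) ≤ P t ^ (r / p) := by
      intro t ht
      have h1 : a j ^ p * 2 ^ (-((j + 1 : ℝ) * p)) ≤ P t := by
        refine le_trans (le_of_eq ?_) (Finset.single_le_sum (f := fun j =>
          (a j ^ p * 2 ^ (-((j + 1 : ℝ) * p))) *
            (Iic (x (j + 1))).indicator (fun _ => (1 : ℝ≥0∞)) t) (fun _ _ => zero_le) hj)
        simp [show t ≤ x (j + 1) from ht.2]
      refine le_trans (le_of_eq ?_) (ENNReal.rpow_le_rpow h1 (by positivity : 0 ≤ r / p))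
      rw [ENNReal.mul_rpow_of_nonneg _ _ (by positivity), ← ENNReal.rpow_mul, ← ENNReal.rpow_mul]
      congr 2 <;> field_simp
    calc (y j * a j) ^ r * 2 ^ (-r)
        = a j ^ r * 2 ^ (-((j + 1 : ℝ) * r)) * U (Ioc (x j) (x (j + 1))) := by
          rw [ENNReal.mul_rpow_of_nonneg _ _ hr.le, hyr,
            show -((j + 1 : ℝ) * r) = -(j * r) + -r by ring, two_rpow_add]
          ring
      _ ≤ _ := by
          rw [← setLIntegral_const]
          exact setLIntegral_mono' measurableSet_Ioc hPj
  have h3 := hlow.trans hmain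
  rw [← Finset.sum_mul] at h3
  calc ∑ j ∈ S, (y j * a j) ^ r = (∑ j ∈ S, (y j * a j) ^ r) * 2 ^ (-r) * 2 ^ r := by
        rw [mul_assoc, two_rpow_neg_mul_self, mul_one]
    _ ≤ h ^ r * 2 ^ r := by gcongr
    _ = (2 * h) ^ r := by rw [ENNReal.mul_rpow_of_nonneg _ _ hr.le, mul_comm]

/-! ### Tails of `γ` and dyadic level sets of a monotone function -/

/-- The last power of `2` below a finite positive `x` is at least `x / 2`. The case `x = ∞` later
shows that the set where a weight is infinite is null. -/
theorem two_mul_of_forall_two_rpow_mul_le {x w L : ℝ≥0∞}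
    (h : ∀ k : ℤ, 2 ^ (k : ℝ) < x → 2 ^ (k : ℝ) * w ≤ L) : x * w ≤ 2 * L := by
  rcases eq_or_ne x 0 with rfl | h0
  · simp
  rcases eq_or_ne x ∞ with rfl | ht
  · have hn : ∀ n : ℕ, (n : ℝ≥0∞) * w ≤ L := fun n => by
      refine le_trans ?_ (h n (lt_top_iff_ne_top.2 (two_rpow_ne_top _)))
      gcongr
      simp only [Int.cast_natCast, ENNReal.rpow_natCast]
      exact_mod_cast (Nat.lt_two_pow_self (n := n)).le
    have : ∞ * w ≤ L := by
      rw [← ENNReal.iSup_natCast, ENNReal.iSup_mul]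
      exact iSup_le hn
    exact this.trans (by rw [two_mul]; exact le_self_add)
  · obtain ⟨k, hk, hk'⟩ := exists_two_rpow_lt_le h0 ht
    calc x * w ≤ 2 ^ ((k : ℝ) + 1) * w := by gcongr
      _ = 2 * (2 ^ (k : ℝ) * w) := by rw [two_rpow_add, ENNReal.rpow_one]; ring
      _ ≤ _ := by gcongr; exact h k hk

theorem tsum_int_eq_tsum_nat {f : ℤ → ℝ≥0∞} {n : ℤ} (h : ∀ k, n < k → f k = 0) :
    ∑' k, f k = ∑' d : ℕ, f (n - d) := by
  rw [← (Equiv.subLeft n).tsum_eq]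
  simp only [Equiv.subLeft_apply]
  symm
  refine Function.Injective.tsum_eq (f := fun j : ℤ => f (n - j)) Nat.cast_injective fun j hj => ?_
  have : 0 ≤ j := by
    by_contra! hlt
    exact hj (h _ (by linarith))
  exact ⟨j.toNat, by simp [this]⟩

/-- Dyadic layer-cake formula, upper half: a geometric sum is comparable to its largest term, which
is less than `x^s`. -/
theorem exists_tsum_indicator_le_rpow {s : ℝ} (hs : 0 < s) :
    ∃ C : ℝ≥0∞, C ≠ ∞ ∧ ∀ x : ℝ≥0∞,
      (∑' k : ℤ, (Ioi ((2 : ℝ≥0∞) ^ (k : ℝ))).indicator (fun _ => 2 ^ (k * s)) x) ≤ C * x ^ s := by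
  refine ⟨1 + ∑' d : ℕ, (2 : ℝ≥0∞) ^ (-(d * s)),
    ENNReal.add_ne_top.2 ⟨ENNReal.one_ne_top, tsum_two_rpow_neg_ne_top hs⟩, fun x => ?_⟩
  rcases eq_or_ne x 0 with rfl | h0
  · simp
  rcases eq_or_ne x ∞ with rfl | ht
  · rw [ENNReal.top_rpow_of_pos hs, ENNReal.mul_top (by simp)]; exact le_top
  obtain ⟨n, hn, hn'⟩ := exists_two_rpow_lt_le h0 ht
  rw [tsum_int_eq_tsum_nat (n := n)]
  · calc ∑' d : ℕ, (Ioi ((2 : ℝ≥0∞) ^ ((n - d : ℤ) : ℝ))).indicator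
          (fun _ => (2 : ℝ≥0∞) ^ ((n - d : ℤ) * s)) x
        ≤ ∑' d : ℕ, 2 ^ (-(d * s)) * (2 ^ (n : ℝ)) ^ s := by
          refine ENNReal.tsum_le_tsum fun d => ?_
          refine (indicator_le_self' (fun _ _ => zero_le) x).trans_eq ?_
          rw [← ENNReal.rpow_mul, ← two_rpow_add]
          congr 1; push_cast; ring
      _ ≤ (∑' d : ℕ, 2 ^ (-(d * s))) * x ^ s := by
          rw [ENNReal.tsum_mul_right]; gcongr
      _ ≤ _ := by gcongr; exact le_add_self
  · intro k hk
    refine indicator_of_notMem ?_ _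
    simp only [mem_Ioi, not_lt]
    refine hn'.trans (two_rpow_le_two_rpow ?_)
    exact_mod_cast hk

theorem rpow_le_tsum_indicator {s : ℝ} (hs : 0 < s) (x : ℝ≥0∞) :
    x ^ s ≤ 2 ^ s * ∑' k : ℤ, (Ioi ((2 : ℝ≥0∞) ^ (k : ℝ))).indicator (fun _ => 2 ^ (k * s)) x := by
  rcases eq_or_ne x 0 with rfl | h0
  · simp [hs]
  rcases eq_or_ne x ∞ with rfl | ht
  · have : ∑' k : ℤ, (Ioi ((2 : ℝ≥0∞) ^ (k : ℝ))).indicator (fun _ => (2 : ℝ≥0∞) ^ (k * s)) ∞ =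
        ∞ := by
      refine top_le_iff.1 ?_
      refine (ENNReal.tsum_const_eq_top_of_ne_zero (α := ℕ) one_ne_zero).ge.trans ?_
      refine le_trans ?_ (ENNReal.tsum_comp_le_tsum_of_injective (Nat.cast_injective (R := ℤ)) _)
      refine ENNReal.tsum_le_tsum fun n => ?_
      rw [indicator_of_mem (mem_Ioi.2 (lt_top_iff_ne_top.2 (two_rpow_ne_top _)))]
      rw [← ENNReal.rpow_zero (x := 2)]
      exact two_rpow_le_two_rpow (by push_cast; positivity)
    rw [this, ENNReal.mul_top (two_rpow_ne_zero _)]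
    exact le_top
  obtain ⟨n, hn, hn'⟩ := exists_two_rpow_lt_le h0 ht
  calc x ^ s ≤ (2 ^ ((n : ℝ) + 1)) ^ s := by gcongr
    _ = 2 ^ s * (Ioi ((2 : ℝ≥0∞) ^ (n : ℝ))).indicator (fun _ => 2 ^ (n * s)) x := by
        rw [indicator_of_mem (mem_Ioi.2 hn), ← ENNReal.rpow_mul, ← two_rpow_add]
        congr 1; ring
    _ ≤ _ := by
        gcongr
        exact ENNReal.le_tsum (f := fun k : ℤ =>
          (Ioi ((2 : ℝ≥0∞) ^ (k : ℝ))).indicator (fun _ => (2 : ℝ≥0∞) ^ (k * s)) x) n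

/-- The norm of the tail of `γ` with the weight `v`. -/
def tailConst (p q : ℝ) (v : J b → ℝ≥0∞) (γ : Measure (J b)) : ℝ≥0∞ :=
  if p ≤ q then ⨆ t : J b, v t * W q γ t
  else (∫⁻ t, v t ^ (p * q / (p - q)) ∂(negStieltjes fun x => W q γ x ^ (p * q / (p - q)))) ^
    (1 / (p * q / (p - q)))

/-- The counterpart of `tailConst` which is expressed by the level sets of `v`. -/
def levelConst (p q : ℝ) (v : J b → ℝ≥0∞) (γ : Measure (J b)) : ℝ≥0∞ :=
  multNorm p q fun k => 2 ^ (k : ℝ) * γ {t | 2 ^ (k : ℝ) < v t} ^ (1 / q)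

theorem isUpperSet_lt {v : J b → ℝ≥0∞} (hv : Monotone v) (c : ℝ≥0∞) : IsUpperSet {t | c < v t} :=
  fun _ _ hst hs => lt_of_lt_of_le hs (hv hst)

theorem measurableSet_lt_of_monotone {v : J b → ℝ≥0∞} (hv : Monotone v) (c : ℝ≥0∞) :
    MeasurableSet {t | c < v t} := measurableSet_lt measurable_const hv.measurable

theorem lintegral_tsum_indicator (U : Measure (J b)) {v : J b → ℝ≥0∞} (hv : Monotone v)
    (a : ℤ → ℝ≥0∞) :
    ∫⁻ t, ∑' k : ℤ, (Ioi ((2 : ℝ≥0∞) ^ (k : ℝ))).indicator (fun _ => a k) (v t) ∂U =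
      ∑' k : ℤ, a k * U {t | 2 ^ (k : ℝ) < v t} := by
  have hm : ∀ k : ℤ, Measurable fun t =>
      (Ioi ((2 : ℝ≥0∞) ^ (k : ℝ))).indicator (fun _ => a k) (v t) := fun k =>
    (measurable_const.indicator measurableSet_Ioi).comp hv.measurable
  rw [lintegral_tsum fun k => (hm k).aemeasurable]
  refine tsum_congr fun k => ?_
  rw [← lintegral_indicator_const (measurableSet_lt_of_monotone hv _)]
  rfl

/-- A level set of `v` is a half-line, exhausted by the `(t,b)` with `t` in it since `γ` has no
atoms, and there `γ(t,b)^(s/q)` is the `-d[W^s]` mass. For `p > q` the layer-cake formula for that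
measure finishes the proof. -/
theorem exists_levelConst_le_tailConst {p q : ℝ} (hp : 0 < p) (hq : 0 < q) :
    ∃ C : ℝ≥0∞, C ≠ ∞ ∧ ∀ (b : EReal) (v : J b → ℝ≥0∞) (γ : Measure (J b)) [NullSingletonClass γ],
      Monotone v → levelConst p q v γ ≤ C * tailConst p q v γ := by
  by_cases hpq : p ≤ q
  · refine ⟨1, ENNReal.one_ne_top, fun b v γ _ hv => ?_⟩
    rw [one_mul, levelConst, multNorm, if_pos hpq, tailConst, if_pos hpq]
    refine iSup_le fun k => ?_
    rw [mul_comm, ← ENNReal.le_div_iff_mul_le (Or.inl (two_rpow_ne_zero _))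
      (Or.inl (two_rpow_ne_top _)), one_div, ENNReal.rpow_inv_le_iff hq]
    refine measure_le_of_isUpperSet_of_nullSingleton γ (isUpperSet_lt hv _) fun t ht => ?_
    rw [← ENNReal.rpow_inv_le_iff hq, ENNReal.le_div_iff_mul_le (Or.inl (two_rpow_ne_zero _))
      (Or.inl (two_rpow_ne_top _)), mul_comm, ← one_div]
    calc 2 ^ (k : ℝ) * γ (Ioi t) ^ (1 / q) ≤ v t * W q γ t := by
          rw [W]
          gcongr
          exact le_of_lt ht
      _ ≤ _ := le_iSup (fun t => v t * W q γ t) t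
  · have hpq' : 0 < p - q := by linarith
    set s := p * q / (p - q) with hsdef
    have hs : 0 < s := div_pos (mul_pos hp hq) hpq'
    obtain ⟨C, hC, hCx⟩ := exists_tsum_indicator_le_rpow hs
    refine ⟨C ^ (1 / s), ENNReal.rpow_ne_top_of_nonneg (by positivity) hC, fun b v γ _ hv => ?_⟩
    simp only [levelConst, multNorm, if_neg hpq, tailConst, ← hsdef]
    rw [← ENNReal.mul_rpow_of_nonneg _ _ (by positivity)]
    refine ENNReal.rpow_le_rpow ?_ (by positivity)
    set l := negStieltjes fun x => W q γ x ^ s with hl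
    have hle : ∀ c : ℝ≥0∞, γ {t | c < v t} ^ (s / q) ≤ l {t | c < v t} := by
      intro c
      have h1 : γ {t | c < v t} ≤ l {t | c < v t} ^ (s / q)⁻¹ := by
        refine measure_le_of_isUpperSet_of_nullSingleton γ (isUpperSet_lt hv _) fun t ht => ?_
        rw [ENNReal.le_rpow_inv_iff (by positivity)]
        have h2 : γ (Ioi t) ^ (s / q) = l (Ioi t) := by
          rw [hl, negStieltjes_W_rpow_Ioi hq hs, W, ← ENNReal.rpow_mul]
          congr 1; ring
        rw [h2]
        exact measure_mono fun x hx => lt_of_lt_of_le ht (hv (le_of_lt hx))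
      rwa [ENNReal.le_rpow_inv_iff (by positivity)] at h1
    calc ∑' k : ℤ, (2 ^ (k : ℝ) * γ {t | 2 ^ (k : ℝ) < v t} ^ (1 / q)) ^ s
        ≤ ∑' k : ℤ, 2 ^ (k * s) * l {t | 2 ^ (k : ℝ) < v t} := by
          refine ENNReal.tsum_le_tsum fun k => ?_
          rw [ENNReal.mul_rpow_of_nonneg _ _ hs.le, ← ENNReal.rpow_mul, ← ENNReal.rpow_mul]
          gcongr
          rw [one_div_mul_eq_div]
          exact hle _
      _ = ∫⁻ t, ∑' k : ℤ, (Ioi ((2 : ℝ≥0∞) ^ (k : ℝ))).indicator (fun _ => 2 ^ (k * s)) (v t) ∂l :=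
          (lintegral_tsum_indicator l hv _).symm
      _ ≤ ∫⁻ t, C * v t ^ s ∂l := lintegral_mono fun t => hCx _
      _ = _ := lintegral_const_mul' _ _ hC

/-- The left-continuity hypothesis says that no level set `{v > c}` contains its left endpoint, so a
possible atom of `-d[W^s]` at that endpoint does not count. -/
theorem exists_tailConst_le_levelConst {p q : ℝ} (hp : 0 < p) (hq : 0 < q) :
    ∃ C : ℝ≥0∞, C ≠ ∞ ∧ ∀ (b : EReal) (v : J b → ℝ≥0∞) (γ : Measure (J b)),
      Monotone v → (∀ t c, c < v t → ∃ t' < t, c < v t') →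
      tailConst p q v γ ≤ C * levelConst p q v γ := by
  refine ⟨2, by norm_num, fun b v γ hv hleft => ?_⟩
  by_cases hpq : p ≤ q
  · rw [levelConst, multNorm, if_pos hpq, tailConst, if_pos hpq]
    refine iSup_le fun t => two_mul_of_forall_two_rpow_mul_le fun k hk => ?_
    refine le_trans ?_
      (le_iSup (fun k : ℤ => (2 : ℝ≥0∞) ^ (k : ℝ) * γ {t | 2 ^ (k : ℝ) < v t} ^ (1 / q)) k)
    rw [W]
    gcongr
    exact fun x hx => lt_of_lt_of_le hk (hv (le_of_lt hx))
  · have hpq' : 0 < p - q := by linarith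
    set s := p * q / (p - q) with hsdef
    have hs : 0 < s := div_pos (mul_pos hp hq) hpq'
    simp only [levelConst, multNorm, if_neg hpq, tailConst, ← hsdef]
    set l := negStieltjes fun x => W q γ x ^ s with hl
    have hle : ∀ c : ℝ≥0∞, l {t | c < v t} ≤ γ {t | c < v t} ^ (s / q) := by
      intro c
      refine measure_le_of_isUpperSet_of_noMin l (isUpperSet_lt hv _) (fun t ht => ?_)
        fun t ht => ?_
      · obtain ⟨t', ht', h⟩ := hleft t c ht
        exact ⟨t', h, ht'⟩
      · have h2 : l (Ioi t) = γ (Ioi t) ^ (s / q) := by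
          rw [hl, negStieltjes_W_rpow_Ioi hq hs, W, ← ENNReal.rpow_mul]
          congr 1; ring
        rw [h2]
        gcongr
        exact fun x hx => lt_of_lt_of_le ht (hv (le_of_lt hx))
    have hmain : ∫⁻ t, v t ^ s ∂l ≤
        2 ^ s * ∑' k : ℤ, (2 ^ (k : ℝ) * γ {t | 2 ^ (k : ℝ) < v t} ^ (1 / q)) ^ s := by
      calc ∫⁻ t, v t ^ s ∂l ≤ ∫⁻ t, 2 ^ s * ∑' k : ℤ,
            (Ioi ((2 : ℝ≥0∞) ^ (k : ℝ))).indicator (fun _ => 2 ^ (k * s)) (v t) ∂l :=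
            lintegral_mono fun t => rpow_le_tsum_indicator hs _
        _ = 2 ^ s * ∑' k : ℤ, 2 ^ (k * s) * l {t | 2 ^ (k : ℝ) < v t} := by
            rw [lintegral_const_mul' _ _ (two_rpow_ne_top _), lintegral_tsum_indicator l hv]
        _ ≤ _ := by
            gcongr with k
            rw [ENNReal.mul_rpow_of_nonneg _ _ hs.le, ← ENNReal.rpow_mul, ← ENNReal.rpow_mul]
            gcongr
            rw [one_div_mul_eq_div]
            exact hle _
    calc _ ≤ (2 ^ s * ∑' k : ℤ, (2 ^ (k : ℝ) * γ {t | 2 ^ (k : ℝ) < v t} ^ (1 / q)) ^ s) ^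
          (1 / s) := ENNReal.rpow_le_rpow hmain (by positivity)
      _ = _ := by
          rw [ENNReal.mul_rpow_of_nonneg _ _ (by positivity), rpow_rpow_one_div _ hs]

/-! ### Slicing a nonincreasing function along the levels of a weight -/

/-- **Minkowski's inequality** for countable sums. -/
theorem lintegral_Lp_tsum_le {α : Type*} [MeasurableSpace α] (U : Measure α) {f : ℕ → α → ℝ≥0∞}
    (hf : ∀ n, Measurable (f n)) {θ : ℝ} (hθ : 1 ≤ θ) :
    (∫⁻ x, (∑' n, f n x) ^ θ ∂U) ^ (1 / θ) ≤ ∑' n, (∫⁻ x, f n x ^ θ ∂U) ^ (1 / θ) := by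
  have hθ0 : 0 < θ := by linarith
  have hfin : ∀ n : ℕ, (∫⁻ x, (∑ i ∈ Finset.range n, f i x) ^ θ ∂U) ^ (1 / θ) ≤
      ∑' n, (∫⁻ x, f n x ^ θ ∂U) ^ (1 / θ) := by
    intro n
    refine le_trans ?_ (ENNReal.sum_le_tsum (Finset.range n))
    induction n with
    | zero => simp [hθ0]
    | succ n ih =>
      simp_rw [Finset.sum_range_succ]
      refine (ENNReal.lintegral_Lp_add_le (f := fun x => ∑ i ∈ Finset.range n, f i x)
        (Finset.measurable_fun_sum _ fun i _ => hf i).aemeasurable (hf n).aemeasurable hθ).trans ?_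
      gcongr
  have hsup : ∀ x, (∑' n, f n x) ^ θ = ⨆ n : ℕ, (∑ i ∈ Finset.range n, f i x) ^ θ := by
    intro x
    rw [ENNReal.tsum_eq_iSup_nat]
    exact (ENNReal.monotone_rpow_of_nonneg hθ0.le).map_iSup_of_continuousAt
      ENNReal.continuous_rpow_const.continuousAt (by simp [hθ0])
  simp_rw [hsup]
  rw [lintegral_iSup]
  · rw [one_div, ENNReal.rpow_inv_le_iff hθ0]
    refine iSup_le fun n => ?_
    rw [← ENNReal.rpow_inv_le_iff hθ0, ← one_div]
    exact hfin n
  · exact fun n => (Finset.measurable_fun_sum _ fun i _ => hf i).pow_const _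
  · intro m n hmn x
    exact ENNReal.rpow_le_rpow (Finset.sum_le_sum_of_subset (Finset.range_mono hmn)) hθ0.le

/-- The infimum of `Q` over the level set `{v ≤ 2 ^ l}`. -/
def levelInf (v Q : J b → ℝ≥0∞) (l : ℤ) : ℝ≥0∞ :=
  ⨅ t ∈ {t | v t ≤ 2 ^ (l : ℝ)}, Q t

/-- The part of `Q` between two consecutive values of `levelInf v Q`. -/
def levelSlice (v Q : J b → ℝ≥0∞) (l : ℤ) (t : J b) : ℝ≥0∞ :=
  min (Q t) (levelInf v Q l) - levelInf v Q (l + 1)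

section slices

variable {v Q : J b → ℝ≥0∞}

theorem levelInf_succ_le (l : ℤ) : levelInf v Q (l + 1) ≤ levelInf v Q l :=
  biInf_mono fun t (ht : v t ≤ 2 ^ (l : ℝ)) =>
    le_trans ht (two_rpow_le_two_rpow (by push_cast; linarith))

theorem levelSlice_anti (hQ : Antitone Q) (l : ℤ) : Antitone (levelSlice v Q l) := fun _ _ h =>
  tsub_le_tsub_right (min_le_min_right _ (hQ h)) _

theorem min_levelInf_eq_add (l : ℤ) (t : J b) : min (Q t) (levelInf v Q l) =
    min (Q t) (levelInf v Q (l + 1)) + levelSlice v Q l t := by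
  rw [levelSlice]
  rcases le_total (Q t) (levelInf v Q (l + 1)) with h | h
  · rw [min_eq_left h, min_eq_left (h.trans (levelInf_succ_le l)), tsub_eq_zero_of_le h, add_zero]
  · rw [min_eq_right h, add_tsub_cancel_of_le (le_min h (levelInf_succ_le l))]

theorem min_levelInf_eq_add_sum (k : ℤ) (n : ℕ) (t : J b) : min (Q t) (levelInf v Q (k - n)) =
    min (Q t) (levelInf v Q k) + ∑ i ∈ Finset.range n, levelSlice v Q (k - 1 - i) t := by
  induction n with
  | zero => simp
  | succ n ih =>
    have h1 : k - ((n + 1 : ℕ) : ℤ) = k - 1 - n := by push_cast; ring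
    have h2 : k - 1 - (n : ℤ) + 1 = k - n := by ring
    rw [Finset.sum_range_succ, ← add_assoc, ← ih, h1, min_levelInf_eq_add, h2]

/-- The slices telescope, so those over any range of consecutive levels sum to at most `Q t`. -/
theorem tsum_levelSlice_le (t : J b) : ∑' l, levelSlice v Q l t ≤ Q t := by
  rw [ENNReal.tsum_eq_iSup_sum]
  refine iSup_le fun S => ?_
  obtain ⟨N, hN⟩ : ∃ N : ℕ, ∀ l ∈ S, |l| ≤ N := by
    refine ⟨(∑ l ∈ S, |l|).toNat, fun l hl => ?_⟩
    have := Finset.single_le_sum (f := fun l : ℤ => |l|) (fun i _ => abs_nonneg i) hl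
    omega
  have hsub : S ⊆ (Finset.range (2 * N + 1)).image fun i : ℕ => ((N : ℤ) + 1) - 1 - i := by
    intro l hl
    have := abs_le.1 (hN l hl)
    refine Finset.mem_image.2 ⟨(N - l).toNat, ?_, ?_⟩
    · simp only [Finset.mem_range]; omega
    · omega
  calc ∑ l ∈ S, levelSlice v Q l t
      ≤ ∑ l ∈ (Finset.range (2 * N + 1)).image fun i : ℕ => ((N : ℤ) + 1) - 1 - i,
          levelSlice v Q l t := Finset.sum_le_sum_of_subset hsub
    _ = ∑ i ∈ Finset.range (2 * N + 1), levelSlice v Q ((N : ℤ) + 1 - 1 - i) t :=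
        Finset.sum_image fun i _ j _ h => by omega
    _ ≤ min (Q t) (levelInf v Q ((N : ℤ) + 1 - (2 * N + 1 : ℕ))) := by
        rw [min_levelInf_eq_add_sum]; exact le_add_self
    _ ≤ Q t := min_le_left _ _

/-- Since `v x > 0`, some level lies below `v x`, and there `levelInf` is at least `Q x`.
Telescoping from it up to level `k + 1`, where `levelInf` is at most `Q t`, leaves only slices of
index at most `k`. -/
theorem le_add_tsum_levelSlice (hv : Monotone v) (hQ : Antitone Q) {k : ℤ} {x t : J b}
    (hx : v x ≠ 0) (hxt : x ≤ t) (ht : v t ≤ 2 ^ ((k : ℝ) + 1)) :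
    Q x ≤ Q t + ∑' d : ℕ, levelSlice v Q (k - d) x := by
  have hvt : v x ≠ ∞ := ne_top_of_le_ne_top (two_rpow_ne_top _) ((hv hxt).trans ht)
  obtain ⟨j, hj, -⟩ := exists_two_rpow_lt_le hx hvt
  set n := (k + 1 - j).toNat with hn
  have hlt : (2 : ℝ≥0∞) ^ ((k + 1 - n : ℤ) : ℝ) < v x := by
    refine lt_of_le_of_lt (two_rpow_le_two_rpow ?_) hj
    have : k + 1 - (n : ℤ) ≤ j := by omega
    exact_mod_cast this
  have hle : Q x ≤ levelInf v Q (k + 1 - n) := by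
    refine le_iInf₂ fun y hy => hQ ?_
    by_contra! hxy
    exact absurd ((hv hxy.le).trans hy) (not_le.2 hlt)
  calc Q x = min (Q x) (levelInf v Q (k + 1 - n)) := (min_eq_left hle).symm
    _ = min (Q x) (levelInf v Q (k + 1)) +
        ∑ i ∈ Finset.range n, levelSlice v Q (k + 1 - 1 - i) x := min_levelInf_eq_add_sum _ _ _
    _ ≤ _ := by
        gcongr
        · refine (min_le_right _ _).trans (iInf₂_le t ?_)
          simpa using ht
        · rw [add_sub_cancel_right]
          exact ENNReal.sum_le_tsum _

/-- Every point with `v ≤ 2^(l+1)` lies to the left of `x`, so `Q x` does not exceed the infimum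
subtracted in slice `l`. Thus slice `l` only sees the region where the embedding constant is at most
`2^(l+1)`. -/
theorem levelSlice_eq_zero (hv : Monotone v) (hQ : Antitone Q) {l : ℤ} {x : J b}
    (hx : 2 ^ ((l : ℝ) + 1) < v x) : levelSlice v Q l x = 0 := by
  refine tsub_eq_zero_of_le ((min_le_left _ _).trans (le_iInf₂ fun y hy => hQ ?_))
  by_contra! hxy
  have hy' : v y ≤ 2 ^ ((l : ℝ) + 1) := by simpa using hy
  exact absurd ((hv hxy.le).trans hy') (not_le.2 hx)

end slices

/-! ### The Hardy inequality: sufficiency -/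

/-- The constants of the embeddings into `L_r` over the initial intervals. -/
def initConst (p r : ℝ) (ω : J b → ℝ≥0∞) (N : Measure (J b)) (t : J b) : ℝ≥0∞ :=
  embConst p r ω (N.restrict (Iic t))

theorem embConst_mono {p r : ℝ} (hp : 0 < p) (hr : 0 < r) (ω : J b → ℝ≥0∞) {U U' : Measure (J b)}
    (h : U ≤ U') : embConst p r ω U ≤ embConst p r ω U' := by
  unfold embConst
  split_ifs with hpr
  · gcongr
  · have : 0 < p * r / (p - r) := div_pos (mul_pos hp hr) (by linarith)
    gcongr

theorem initConst_mono {p r : ℝ} (hp : 0 < p) (hr : 0 < r) (ω : J b → ℝ≥0∞) (N : Measure (J b)) :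
    Monotone (initConst p r ω N) := fun _ _ h =>
  embConst_mono hp hr ω (Measure.restrict_mono (Iic_subset_Iic.2 h) le_rfl)

/-- Apply the embedding inequality to the indicator of `(0,t]`. This disposes of the points where
`initConst` vanishes, which belong to no dyadic level. -/
theorem measure_Iic_eq_zero_of_initConst_eq_zero {p r : ℝ} (hp : 0 < p) (hr : 0 < r)
    [Nonempty (J b)] {B : Measure (J b)} {ω : J b → ℝ≥0∞} (hω : IsWeight p B ω)
    (N : Measure (J b)) {t : J b} (ht : initConst p r ω N t = 0) : N (Iic t) = 0 := by
  obtain ⟨C, hC, h⟩ := exists_lintegral_rpow_le_embConst hp hr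
  have h1 := h b B ω (N.restrict (Iic t)) hω ((Iic t).indicator fun _ => 1)
    (IsTest.indicator_Iic t).anti
  have h2 : ∀ (a : ℝ), 0 < a → (fun s : J b => (Iic t).indicator (fun _ => (1 : ℝ≥0∞)) s ^ a) =
      (Iic t).indicator fun _ => (1 : ℝ≥0∞) := by
    intro a ha
    ext s
    by_cases hs : s ∈ Iic t <;> simp [hs, ha]
  rw [← initConst, ht, h2 r hr, ENNReal.zero_rpow_of_pos hr, mul_zero, zero_mul,
    lintegral_indicator_const measurableSet_Iic, one_mul,
    Measure.restrict_apply measurableSet_Iic, inter_self] at h1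
  exact le_antisymm h1 zero_le

theorem antitone_rpow {Q : J b → ℝ≥0∞} (hQ : Antitone Q) {a : ℝ} (ha : 0 ≤ a) :
    Antitone fun t => Q t ^ a := fun _ _ h => ENNReal.rpow_le_rpow (hQ h) ha

/-- A nonincreasing function vanishing outside a level set of `initConst`. -/
theorem exists_lintegral_rpow_le_of_support {p r : ℝ} (hp : 0 < p) (hr : 0 < r) :
    ∃ C : ℝ≥0∞, C ≠ ∞ ∧ ∀ (b : EReal) [Nonempty (J b)] (B : Measure (J b)) (ω : J b → ℝ≥0∞)
      (N : Measure (J b)), IsWeight p B ω → ∀ g : J b → ℝ≥0∞, Antitone g → ∀ c : ℝ≥0∞,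
      (∀ x, c < initConst p r ω N x → g x = 0) →
      ∫⁻ t, g t ^ r ∂N ≤ C * c ^ r * (∫⁻ t, g t ^ p ∂B) ^ (r / p) := by
  obtain ⟨C, hC, h⟩ := exists_lintegral_rpow_le_embConst hp hr
  refine ⟨C, hC, fun b _ B ω N hω g hg c hgc => ?_⟩
  have hm : Measurable fun t => g t ^ r := hg.measurable.pow_const r
  set S : Set (J b) := {x | initConst p r ω N x ≤ c} with hS
  have hSl : IsLowerSet S := fun x y hyx hx => (initConst_mono hp hr ω N hyx).trans hx
  have hSm : MeasurableSet S := hSl.ordConnected.measurableSet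
  -- Read as the mass of a lower set for the measure `g^r dN`, the integral is exhausted by initial
  -- intervals `(0,x]` on which the embedding constant is at most `c`.
  have h1 : ∫⁻ t, g t ^ r ∂N = N.withDensity (fun t => g t ^ r) S := by
    rw [withDensity_apply _ hSm, ← lintegral_indicator hSm]
    refine lintegral_congr fun t => ?_
    by_cases ht : t ∈ S
    · rw [indicator_of_mem ht]
    · rw [indicator_of_notMem ht, hgc t (not_le.1 ht), ENNReal.zero_rpow_of_pos hr]
  rw [h1]
  refine measure_le_of_isLowerSet _ hSl fun x hx => ?_
  rw [withDensity_apply _ measurableSet_Iic]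
  refine (h b B ω (N.restrict (Iic x)) hω g hg).trans ?_
  gcongr
  exact hx

/-- The Hardy inequality for nonincreasing functions: sufficiency. -/
theorem exists_hardy_le {p q r : ℝ} (hp : 0 < p) (hq : 0 < q) (hr : 0 < r) :
    ∃ C : ℝ≥0∞, C ≠ ∞ ∧ ∀ (b : EReal) [Nonempty (J b)] (B : Measure (J b)) (ω : J b → ℝ≥0∞)
      (N γ : Measure (J b)), IsWeight p B ω →
      levelConst p q (initConst p r ω N) γ ≠ ∞ → ∀ g : J b → ℝ≥0∞, Antitone g →
      ∫⁻ t, (∫⁻ x in Iic t, g x ^ r ∂N) ^ (q / r) ∂γ ≤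
        C * (embConst p q ω (γ.withDensity fun t => N (Iic t) ^ (q / r)) ^ q +
          levelConst p q (initConst p r ω N) γ ^ q) * (∫⁻ t, g t ^ p ∂B) ^ (q / p) := by
  obtain ⟨C₁, hC₁, hE⟩ := exists_lintegral_rpow_le_embConst hp hq
  obtain ⟨C₂, hC₂, hV⟩ := exists_lintegral_rpow_le_of_support hp hr
  -- Both `p/m ≥ 1` and `r/m ≥ 1` are needed: the first makes the `p/m`-th powers of the slices sum
  -- to at most `g^p`, the second permits Minkowski's inequality in `L_{r/m}(N)`.
  set m := min p r with hm
  have hm0 : 0 < m := lt_min hp hr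
  obtain ⟨C₃, hC₃, hH⟩ := exists_tsum_geometric_le_multNorm hp hq hm0
  set D : ℝ≥0∞ := C₂ ^ (q / r) * 2 ^ q with hD
  have hDt : D ≠ ∞ :=
    ENNReal.mul_ne_top (ENNReal.rpow_ne_top_of_nonneg (by positivity) hC₂) (two_rpow_ne_top _)
  refine ⟨2 ^ (q / m) * (C₁ + D * C₃), ENNReal.mul_ne_top (two_rpow_ne_top _)
    (ENNReal.add_ne_top.2 ⟨hC₁, ENNReal.mul_ne_top hDt hC₃⟩),
    fun b _ B ω N γ hω hL g hg => ?_⟩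
  set v := initConst p r ω N with hv
  have hvm : Monotone v := initConst_mono hp hr ω N
  set Q : J b → ℝ≥0∞ := fun t => g t ^ m with hQdef
  have hQ : Antitone Q := antitone_rpow hg hm0.le
  have hsl : ∀ l, Antitone (levelSlice v Q l) := levelSlice_anti hQ
  set A : ℤ → ℝ≥0∞ := fun l => (∫⁻ t, levelSlice v Q l t ^ (p / m) ∂B) ^ (1 / p) with hA
  have hAsum : ∑' l, A l ^ p ≤ ∫⁻ t, g t ^ p ∂B := by
    simp only [hA, rpow_one_div_rpow _ hp]
    rw [← lintegral_tsum fun l => ((hsl l).measurable.pow_const _).aemeasurable]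
    refine lintegral_mono fun t => ?_
    calc ∑' l, levelSlice v Q l t ^ (p / m) ≤ (∑' l, levelSlice v Q l t) ^ (p / m) :=
          tsum_rpow_le_rpow_tsum _ ((one_le_div hm0).2 (min_le_left _ _))
      _ ≤ Q t ^ (p / m) := by
          gcongr
          exact tsum_levelSlice_le t
      _ = g t ^ p := by
          rw [hQdef, ← ENNReal.rpow_mul, mul_div_cancel₀ _ hm0.ne']
  have hslice : ∀ l, (∫⁻ x, levelSlice v Q l x ^ (r / m) ∂N) ^ (m / r) ≤
      C₂ ^ (m / r) * (2 ^ ((l : ℝ) + 1) * A l) ^ m := by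
    intro l
    have h1 := hV b B ω N hω (fun t => levelSlice v Q l t ^ (1 / m))
      (antitone_rpow (hsl l) (by positivity)) (2 ^ ((l : ℝ) + 1)) fun x hx => by
        rw [levelSlice_eq_zero hvm hQ hx, ENNReal.zero_rpow_of_pos (by positivity)]
    simp only [← ENNReal.rpow_mul, one_div_mul_eq_div] at h1
    have h2 := ENNReal.rpow_le_rpow h1 (by positivity : 0 ≤ m / r)
    refine h2.trans_eq ?_
    rw [ENNReal.mul_rpow_of_nonneg _ _ (by positivity),
      ENNReal.mul_rpow_of_nonneg _ _ (by positivity), ENNReal.mul_rpow_of_nonneg _ _ hm0.le,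
      mul_assoc]
    simp only [hA, ← ENNReal.rpow_mul]
    congr 3
    · field_simp
    · field_simp
  set Y : ℤ → ℝ≥0∞ := fun k => (∑' d : ℕ, (2 ^ (-(d : ℝ)) * A (k - d)) ^ m) ^ (q / m) with hY
  have hN0 : N {x | v x = 0} = 0 := by
    refine le_antisymm ?_ zero_le
    refine measure_le_of_isLowerSet N (fun x y hyx hx => ?_) fun x hx => ?_
    · exact le_antisymm ((hvm hyx).trans_eq hx) zero_le
    · exact (measure_Iic_eq_zero_of_initConst_eq_zero hp hr hω N hx).le
  -- Minkowski splits the inner integral into the constant `g(t)^m`, which will produce `E`, and the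
  -- slices of index `k - d`, each bounded by `(2^(k-d+1) A (k-d))^m` up to a constant. Factoring
  -- out `2^(km)` leaves the average `Y k`.
  have hlevel : ∀ (k : ℤ) (t : J b), v t ≤ 2 ^ ((k : ℝ) + 1) →
      (∫⁻ x in Iic t, g x ^ r ∂N) ^ (q / r) ≤
        2 ^ (q / m) * (g t ^ q * N (Iic t) ^ (q / r) + D * (2 ^ (k * q) * Y k)) := by
    intro k t ht
    have h1 : ∫⁻ x in Iic t, g x ^ r ∂N ≤
        ∫⁻ x in Iic t, (Q t + ∑' d : ℕ, levelSlice v Q (k - d) x) ^ (r / m) ∂N := by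
      refine lintegral_mono_ae ?_
      have hae : ∀ᵐ x ∂(N.restrict (Iic t)), v x ≠ 0 :=
        ae_restrict_of_ae (by rw [ae_iff]; simpa using hN0)
      filter_upwards [hae, ae_restrict_mem measurableSet_Iic] with x hx hxt
      calc g x ^ r = Q x ^ (r / m) := by
            rw [hQdef, ← ENNReal.rpow_mul, mul_div_cancel₀ _ hm0.ne']
        _ ≤ _ := by
            gcongr
            exact le_add_tsum_levelSlice hvm hQ hx hxt ht
    have h2 : (∫⁻ x in Iic t, g x ^ r ∂N) ^ (m / r) ≤
        (g t * N (Iic t) ^ (1 / r)) ^ m +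
          C₂ ^ (m / r) * 2 ^ m * 2 ^ (k * m) * ∑' d : ℕ, (2 ^ (-(d : ℝ)) * A (k - d)) ^ m := by
      have hθ : 1 ≤ r / m := (one_le_div hm0).2 (min_le_right _ _)
      have hmr : m / r = 1 / (r / m) := by field_simp
      rw [hmr]
      refine (ENNReal.rpow_le_rpow h1 (by positivity)).trans ?_
      refine (ENNReal.lintegral_Lp_add_le (f := fun _ => Q t)
        (g := fun x => ∑' d : ℕ, levelSlice v Q (k - d) x) aemeasurable_const
        (Measurable.tsum fun d => (hsl _).measurable).aemeasurable hθ).trans ?_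
      refine add_le_add (le_of_eq ?_) ?_
      · rw [setLIntegral_const, ENNReal.mul_rpow_of_nonneg _ _ (by positivity),
          ENNReal.mul_rpow_of_nonneg _ _ hm0.le, rpow_rpow_one_div _ (by positivity),
          ← ENNReal.rpow_mul, ← hmr, one_div_mul_eq_div]
      · refine (lintegral_Lp_tsum_le _ (fun d => (hsl _).measurable) hθ).trans ?_
        rw [← ENNReal.tsum_mul_left]
        refine ENNReal.tsum_le_tsum fun d => ?_
        rw [← hmr]
        calc _ ≤ (∫⁻ x, levelSlice v Q (k - d) x ^ (r / m) ∂N) ^ (m / r) := by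
              gcongr
              exact Measure.restrict_le_self
          _ ≤ _ := hslice _
          _ = _ := by
              have : (2 : ℝ≥0∞) ^ (((k - d : ℤ) : ℝ) + 1) * A (k - d) =
                  2 ^ (k : ℝ) * 2 * (2 ^ (-(d : ℝ)) * A (k - d)) := by
                rw [← mul_assoc]
                congr 1
                nth_rewrite 3 [← ENNReal.rpow_one 2]
                rw [← two_rpow_add, ← two_rpow_add]
                congr 1; push_cast; ring
              rw [this, ENNReal.mul_rpow_of_nonneg _ _ hm0.le,
                ENNReal.mul_rpow_of_nonneg (2 ^ (k : ℝ)) _ hm0.le, ← ENNReal.rpow_mul]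
              ring
    have h3 := ENNReal.rpow_le_rpow h2 (by positivity : 0 ≤ q / m)
    rw [← ENNReal.rpow_mul, show m / r * (q / m) = q / r by field_simp] at h3
    refine h3.trans ((add_rpow_le_two_rpow_mul _ _ (by positivity)).trans_eq ?_)
    congr 2
    · rw [← ENNReal.rpow_mul, mul_div_cancel₀ _ hm0.ne', ENNReal.mul_rpow_of_nonneg _ _ hq.le,
        ← ENNReal.rpow_mul, one_div_mul_eq_div]
    · rw [ENNReal.mul_rpow_of_nonneg _ _ (by positivity),
        ENNReal.mul_rpow_of_nonneg _ _ (by positivity),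
        ENNReal.mul_rpow_of_nonneg _ _ (by positivity), ← ENNReal.rpow_mul, ← ENNReal.rpow_mul,
        ← ENNReal.rpow_mul, show m / r * (q / m) = q / r by field_simp,
        mul_div_cancel₀ _ hm0.ne', show (k : ℝ) * m * (q / m) = k * q by field_simp, hD, hY]
      ring
  have hpt : ∀ t, v t ≠ ∞ → (∫⁻ x in Iic t, g x ^ r ∂N) ^ (q / r) ≤
      2 ^ (q / m) * (g t ^ q * N (Iic t) ^ (q / r) + D *
        ∑' k : ℤ, (Ioi ((2 : ℝ≥0∞) ^ (k : ℝ))).indicator (fun _ => 2 ^ (k * q) * Y k) (v t)) := by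
    intro t ht
    rcases eq_or_ne (v t) 0 with h0 | h0
    · have hz := measure_Iic_eq_zero_of_initConst_eq_zero hp hr hω N h0
      rw [setLIntegral_measure_zero _ _ hz, ENNReal.zero_rpow_of_pos (by positivity)]
      exact zero_le
    · obtain ⟨k, hk, hk'⟩ := exists_two_rpow_lt_le h0 ht
      refine (hlevel k t hk').trans ?_
      gcongr
      refine le_trans (le_of_eq ?_) (ENNReal.le_tsum (f := fun k : ℤ =>
        (Ioi ((2 : ℝ≥0∞) ^ (k : ℝ))).indicator (fun _ => (2 : ℝ≥0∞) ^ (k * q) * Y k) (v t)) k)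
      rw [indicator_of_mem (mem_Ioi.2 hk)]
  -- The pointwise bound needs a finite level for `t`; finiteness of `levelConst` makes the
  -- exceptional set null for `γ`.
  have htop : ∀ᵐ t ∂γ, v t ≠ ∞ := by
    rw [ae_iff]
    simp only [not_not]
    have h1 : ∞ * γ {t | v t = ∞} ^ (1 / q) ≤ 2 * levelConst p q v γ := by
      refine two_mul_of_forall_two_rpow_mul_le fun k hk => ?_
      refine le_trans ?_ (le_multNorm hp hq _ k)
      gcongr with x
      intro hx
      rw [hx]; exact hk
    by_contra hne
    rw [ENNReal.top_mul (by simpa [hq, hq.le] using hne)] at h1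
    exact ENNReal.mul_ne_top (by norm_num) hL (top_le_iff.1 h1)
  have hNm : Measurable fun t => N (Iic t) ^ (q / r) :=
    (Monotone.measurable fun x y h => measure_mono (Iic_subset_Iic.2 h)).pow_const _
  have hgm : Measurable fun t => g t ^ q := hg.measurable.pow_const _
  have hEg : ∫⁻ t, g t ^ q * N (Iic t) ^ (q / r) ∂γ ≤
      C₁ * embConst p q ω (γ.withDensity fun t => N (Iic t) ^ (q / r)) ^ q *
        (∫⁻ t, g t ^ p ∂B) ^ (q / p) := by
    refine le_trans (le_of_eq ?_) (hE b B ω (γ.withDensity fun t => N (Iic t) ^ (q / r)) hω g hg)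
    rw [lintegral_withDensity_eq_lintegral_mul _ hNm hgm]
    exact lintegral_congr fun t => mul_comm _ _
  -- This is the discrete Hardy inequality with multiplier `2^k γ{v > 2^k}^{1/q}` and sequence `A`.
  have hFg : ∑' k : ℤ, 2 ^ (k * q) * Y k * γ {t | 2 ^ (k : ℝ) < v t} ≤
      C₃ * levelConst p q v γ ^ q * (∫⁻ t, g t ^ p ∂B) ^ (q / p) := by
    calc ∑' k : ℤ, 2 ^ (k * q) * Y k * γ {t | 2 ^ (k : ℝ) < v t}
        = ∑' k : ℤ, (2 ^ (k : ℝ) * γ {t | 2 ^ (k : ℝ) < v t} ^ (1 / q)) ^ q * Y k := by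
          refine tsum_congr fun k => ?_
          rw [ENNReal.mul_rpow_of_nonneg _ _ hq.le, rpow_one_div_rpow _ hq, ← ENNReal.rpow_mul]
          ring
      _ ≤ C₃ * levelConst p q v γ ^ q * (∑' l, A l ^ p) ^ (q / p) := hH _ _
      _ ≤ _ := by gcongr
  calc ∫⁻ t, (∫⁻ x in Iic t, g x ^ r ∂N) ^ (q / r) ∂γ
      ≤ ∫⁻ t, 2 ^ (q / m) * (g t ^ q * N (Iic t) ^ (q / r) + D *
        ∑' k : ℤ, (Ioi ((2 : ℝ≥0∞) ^ (k : ℝ))).indicator (fun _ => 2 ^ (k * q) * Y k) (v t)) ∂γ :=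
        lintegral_mono_ae (htop.mono hpt)
    _ = 2 ^ (q / m) * (∫⁻ t, g t ^ q * N (Iic t) ^ (q / r) ∂γ +
          D * ∑' k : ℤ, 2 ^ (k * q) * Y k * γ {t | 2 ^ (k : ℝ) < v t}) := by
        rw [lintegral_const_mul' _ _ (two_rpow_ne_top _), lintegral_add_left (f := fun t => g t ^ q * N (Iic t) ^ (q / r)) (hgm.mul hNm),
          lintegral_const_mul' _ _ hDt, lintegral_tsum_indicator γ hvm]
    _ ≤ 2 ^ (q / m) * (C₁ * embConst p q ω (γ.withDensity fun t => N (Iic t) ^ (q / r)) ^ q *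
          (∫⁻ t, g t ^ p ∂B) ^ (q / p) +
          D * (C₃ * levelConst p q v γ ^ q * (∫⁻ t, g t ^ p ∂B) ^ (q / p))) := by gcongr
    _ ≤ _ := by
        set E' := embConst p q ω (γ.withDensity fun t => N (Iic t) ^ (q / r)) ^ q
        set L' := levelConst p q v γ ^ q
        set G' := (∫⁻ t, g t ^ p ∂B) ^ (q / p)
        calc _ = 2 ^ (q / m) * (C₁ * E' + D * C₃ * L') * G' := by ring
          _ ≤ 2 ^ (q / m) * ((C₁ + D * C₃) * E' + (C₁ + D * C₃) * L') * G' := by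
              gcongr
              · exact le_self_add
              · exact le_add_self
          _ = _ := by ring

/-! ### The Hardy inequality: necessity -/

/-- `H` bounds the Hardy operator on the unit ball of nonincreasing functions. -/
def IsHardyBound (p q r : ℝ) (B N γ : Measure (J b)) (H : ℝ≥0∞) : Prop :=
  ∀ P : J b → ℝ≥0∞, IsTest P → ∫⁻ t, P t ∂B ≤ 1 →
    ∫⁻ t, (∫⁻ x in Iic t, P x ^ (r / p) ∂N) ^ (q / r) ∂γ ≤ H ^ q

namespace IsHardyBound

variable {p q r : ℝ} {B N γ : Measure (J b)} {H : ℝ≥0∞}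

/-- As `P ≥ P t` on `(0,t]`, the inner integral is at least `P(t)^(r/p) N(0,t]`. Together with
`exists_embConst_le` this yields the bound on `E`. -/
theorem lintegral_withDensity_le (h : IsHardyBound p q r B N γ H) (hp : 0 < p) (hq : 0 < q)
    (hr : 0 < r) {P : J b → ℝ≥0∞} (hP : IsTest P) (hP1 : ∫⁻ t, P t ∂B ≤ 1) :
    ∫⁻ t, P t ^ (q / p) ∂(γ.withDensity fun t => N (Iic t) ^ (q / r)) ≤ H ^ q := by
  have hNm : Measurable fun t => N (Iic t) ^ (q / r) :=
    (Monotone.measurable fun x y h => measure_mono (Iic_subset_Iic.2 h)).pow_const _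
  rw [lintegral_withDensity_eq_lintegral_mul _ hNm (hP.anti.measurable.pow_const _)]
  refine (lintegral_mono fun t => ?_).trans (h P hP hP1)
  calc N (Iic t) ^ (q / r) * P t ^ (q / p) = (P t ^ (r / p) * N (Iic t)) ^ (q / r) := by
        rw [ENNReal.mul_rpow_of_nonneg _ _ (by positivity), ← ENNReal.rpow_mul, mul_comm]
        congr 2; field_simp
    _ ≤ _ := by
        gcongr
        rw [← setLIntegral_const]
        refine setLIntegral_mono' measurableSet_Iic fun x hx => ?_
        gcongr
        exact hP.anti hx

/-- Restrict the outer integral to `(t,b)`, where the inner integral dominates the one over `(0,t]`.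
If `γ(t,b) = ∞`, finiteness of `H` forces the inner integral to vanish. -/
theorem lintegral_Iic_le (h : IsHardyBound p q r B N γ H) (hH : H ≠ ∞) (hq : 0 < q)
    (hr : 0 < r) {P : J b → ℝ≥0∞} (hP : IsTest P) (hP1 : ∫⁻ t, P t ∂B ≤ 1) {t : J b}
    (ht : γ (Ioi t) ≠ 0) :
    ∫⁻ x in Iic t, P x ^ (r / p) ∂N ≤ (H * (γ (Ioi t) ^ (1 / q))⁻¹) ^ r := by
  have h1 : (∫⁻ x in Iic t, P x ^ (r / p) ∂N) ^ (q / r) * γ (Ioi t) ≤ H ^ q := by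
    refine le_trans ?_ (h P hP hP1)
    refine le_trans ?_ (setLIntegral_le_lintegral (Ioi t) _)
    rw [← setLIntegral_const]
    refine setLIntegral_mono' measurableSet_Ioi fun x hx => ?_
    gcongr
    exact le_of_lt hx
  set X := ∫⁻ x in Iic t, P x ^ (r / p) ∂N
  rcases eq_or_ne (γ (Ioi t)) ∞ with hinf | hfin
  · by_cases hX : X = 0
    · rw [hX]; exact zero_le
    · rw [hinf, ENNReal.mul_top (by simp [hX, (div_pos hq hr).not_gt]), top_le_iff] at h1
      exact absurd h1 (ENNReal.rpow_ne_top_of_nonneg hq.le hH)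
  · have h2 : X ^ (q / r) ≤ H ^ q * (γ (Ioi t))⁻¹ := by
      rw [← div_eq_mul_inv]
      exact (ENNReal.le_div_iff_mul_le (Or.inl ht) (Or.inl hfin)).2 h1
    have h3 := ENNReal.rpow_le_rpow h2 (by positivity : 0 ≤ r / q)
    rw [← ENNReal.rpow_mul, show q / r * (r / q) = 1 by field_simp, ENNReal.rpow_one] at h3
    refine h3.trans_eq ?_
    rw [ENNReal.mul_rpow_of_nonneg _ _ (by positivity), ENNReal.mul_rpow_of_nonneg _ _ hr.le,
      ← ENNReal.rpow_mul, ENNReal.inv_rpow, ENNReal.inv_rpow, ← ENNReal.rpow_mul]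
    congr 3
    · field_simp
    · ring

end IsHardyBound

/-- The level set `{2 ^ k < v ≤ 2 ^ (k + 1)}`. -/
def levelBlock (v : J b → ℝ≥0∞) (k : ℤ) : Set (J b) :=
  {t | 2 ^ (k : ℝ) < v t} ∩ {t | v t ≤ 2 ^ ((k : ℝ) + 1)}

theorem measurableSet_levelBlock {v : J b → ℝ≥0∞} (hv : Monotone v) (k : ℤ) :
    MeasurableSet (levelBlock v k) :=
  (measurableSet_lt_of_monotone hv _).inter (measurableSet_le hv.measurable measurable_const)

theorem levelBlock_disjoint (v : J b → ℝ≥0∞) : Pairwise (Function.onFun Disjoint (levelBlock v)) := by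
  have key : ∀ i j : ℤ, i < j → Disjoint (levelBlock v i) (levelBlock v j) := by
    intro i j hij
    rw [Set.disjoint_left]
    intro t hi hj
    refine absurd (lt_of_lt_of_le hj.1 hi.2) (not_lt.2 (two_rpow_le_two_rpow ?_))
    exact_mod_cast hij
  intro i j hij
  rcases lt_or_gt_of_ne hij with h | h
  · exact key i j h
  · exact (key j i h).symm

theorem levelSet_subset (v : J b → ℝ≥0∞) (k : ℤ) :
    {t | 2 ^ (k : ℝ) < v t} ⊆ {t | v t = ∞} ∪ ⋃ d : ℕ, levelBlock v (k + d) := by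
  intro t ht
  by_cases htop : v t = ∞
  · exact Or.inl htop
  · right
    have h0 : v t ≠ 0 := (lt_of_le_of_lt zero_le ht).ne'
    obtain ⟨j, hj, hj'⟩ := exists_two_rpow_lt_le h0 htop
    have hkj : k < j + 1 := by
      by_contra! hle
      refine absurd (lt_of_lt_of_le ht hj') (not_lt.2 (two_rpow_le_two_rpow ?_))
      exact_mod_cast hle
    refine mem_iUnion.2 ⟨(j - k).toNat, ?_⟩
    have : k + ((j - k).toNat : ℤ) = j := by omega
    rw [this]
    exact ⟨hj, hj'⟩

/-- The Hardy inequality for nonincreasing functions: necessity of the condition on the level sets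
of `initConst`. -/
theorem exists_levelConst_le {p q r : ℝ} (hp : 0 < p) (hq : 0 < q) (hr : 0 < r) :
    ∃ C : ℝ≥0∞, C ≠ ∞ ∧ ∀ (b : EReal) [Nonempty (J b)] (B : Measure (J b)) (ω : J b → ℝ≥0∞)
      (N γ : Measure (J b)) [NullSingletonClass γ], IsWeight p B ω → ∀ H : ℝ≥0∞,
      IsHardyBound p q r B N γ H → levelConst p q (initConst p r ω N) γ ≤ C * H := by
  obtain ⟨C₀', hC₀', hV'⟩ := exists_embConst_le hp hr
  -- The constant is enlarged to be nonzero, since nearly extremal functions are selected below with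
  -- its inverse.
  obtain ⟨C₀, hC₀, hC₀0, hV⟩ : ∃ C : ℝ≥0∞, C ≠ ∞ ∧ C ≠ 0 ∧ ∀ (b : EReal) [Nonempty (J b)]
      (B : Measure (J b)) (ω : J b → ℝ≥0∞)
      (U : Measure (J b)), IsWeight p B ω → ∀ h : ℝ≥0∞,
      (∀ P : J b → ℝ≥0∞, IsTest P → ∫⁻ t, P t ∂B ≤ 1 → ∫⁻ t, P t ^ (r / p) ∂U ≤ h ^ r) →
      embConst p r ω U ≤ C * h := by
    refine ⟨C₀' + 1, ENNReal.add_ne_top.2 ⟨hC₀', ENNReal.one_ne_top⟩, by simp,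
      fun b _ B ω U hω h hh => (hV' b B ω U hω h hh).trans ?_⟩
    gcongr
    exact le_self_add
  obtain ⟨C₁, hC₁, hgeo⟩ := exists_multNorm_le_of_geometric hp hq
  set D : ℝ≥0∞ := 2 ^ (1 / q) * C₀ with hD
  have hDt : D ≠ ∞ := ENNReal.mul_ne_top (two_rpow_ne_top _) hC₀
  refine ⟨C₁ * D + C₀ + 1, by simp [ENNReal.mul_ne_top, hC₁, hDt, hC₀],
    fun b _ B ω N γ _ hω H hH => ?_⟩
  rcases eq_or_ne H ∞ with rfl | hHt
  · rw [ENNReal.mul_top (by simp)]; exact le_top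
  set v := initConst p r ω N with hv
  have hvm : Monotone v := initConst_mono hp hr ω N
  -- This crude uniform bound only serves to make the level sets finite for `γ` and the set `{v =
  -- ∞}` null, so that blocks can be halved and a level set is covered by its blocks up to a null
  -- set.
  have hvW : ∀ t, v t * γ (Ioi t) ^ (1 / q) ≤ C₀ * H := by
    intro t
    by_cases ht : γ (Ioi t) = 0
    · rw [ht, ENNReal.zero_rpow_of_pos (by positivity), mul_zero]; exact zero_le
    · have h1 := hV b B ω (N.restrict (Iic t)) hω (H * (γ (Ioi t) ^ (1 / q))⁻¹)
        fun P hP hP1 => hH.lintegral_Iic_le hHt hq hr hP hP1 ht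
      calc v t * γ (Ioi t) ^ (1 / q)
          ≤ C₀ * (H * (γ (Ioi t) ^ (1 / q))⁻¹) * γ (Ioi t) ^ (1 / q) := by gcongr; exact h1
        _ = C₀ * H * ((γ (Ioi t) ^ (1 / q))⁻¹ * γ (Ioi t) ^ (1 / q)) := by ring
        _ ≤ C₀ * H * 1 := by gcongr; exact ENNReal.inv_mul_le_one _
        _ = C₀ * H := mul_one _
  have hC₀H : C₀ * H ≠ ∞ := ENNReal.mul_ne_top hC₀ hHt
  have hlev : ∀ k : ℤ, 2 ^ (k : ℝ) * γ {t | 2 ^ (k : ℝ) < v t} ^ (1 / q) ≤ C₀ * H := by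
    intro k
    rw [mul_comm, ← ENNReal.le_div_iff_mul_le (Or.inl (two_rpow_ne_zero _))
      (Or.inl (two_rpow_ne_top _)), one_div, ENNReal.rpow_inv_le_iff hq]
    refine measure_le_of_isUpperSet_of_nullSingleton γ (isUpperSet_lt hvm _) fun t ht => ?_
    rw [← ENNReal.rpow_inv_le_iff hq, ENNReal.le_div_iff_mul_le (Or.inl (two_rpow_ne_zero _))
      (Or.inl (two_rpow_ne_top _)), mul_comm, ← one_div]
    refine le_trans ?_ (hvW t)
    gcongr
    exact le_of_lt ht
  have hfin : ∀ k : ℤ, γ {t | 2 ^ (k : ℝ) < v t} ≠ ∞ := by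
    intro k hk
    have h1 := hlev k
    rw [hk, ENNReal.top_rpow_of_pos (by positivity), ENNReal.mul_top (two_rpow_ne_zero _)] at h1
    exact hC₀H (top_le_iff.1 h1)
  have htop : γ {t | v t = ∞} = 0 := by
    have h1 : ∞ * γ {t | v t = ∞} ^ (1 / q) ≤ 2 * (C₀ * H) := by
      refine two_mul_of_forall_two_rpow_mul_le fun k hk => ?_
      refine le_trans ?_ (hlev k)
      gcongr with x
      intro hx
      rw [hx]; exact hk
    by_contra hne
    rw [ENNReal.top_mul (by simpa [hq, hq.le] using hne)] at h1
    exact ENNReal.mul_ne_top (by norm_num) hC₀H (top_le_iff.1 h1)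
  set y : ℤ → ℝ≥0∞ := fun k => 2 ^ (k : ℝ) * γ (levelBlock v k) ^ (1 / q) with hy
  have hyq : ∀ k, y k ^ q = 2 ^ (k * q) * γ (levelBlock v k) := fun k => by
    simp only [hy]
    rw [ENNReal.mul_rpow_of_nonneg _ _ hq.le, rpow_one_div_rpow _ hq, ← ENNReal.rpow_mul]
  have hcy : levelConst p q v γ ≤ C₁ * multNorm p q y := by
    refine hgeo (fun d => Equiv.addRight (d : ℤ)) _ y fun k => ?_
    rw [ENNReal.mul_rpow_of_nonneg _ _ hq.le, rpow_one_div_rpow _ hq, ← ENNReal.rpow_mul]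
    calc 2 ^ (k * q) * γ {t | 2 ^ (k : ℝ) < v t}
        ≤ 2 ^ (k * q) * ∑' d : ℕ, γ (levelBlock v (k + d)) := by
          gcongr
          refine (measure_mono (levelSet_subset v k)).trans ((measure_union_le _ _).trans ?_)
          rw [htop, zero_add]
          exact measure_iUnion_le _
      _ = _ := by
          rw [← ENNReal.tsum_mul_left]
          refine tsum_congr fun d => ?_
          rw [Equiv.coe_addRight, hyq, ← mul_assoc, ← two_rpow_add]
          congr 2
          push_cast; ring
  -- A single function must be nearly extremal for many `t` in the block. It is chosen at a point
  -- `t₀` of the level set beyond which at least half of the `γ`-mass of the block lies; its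
  -- integral over `(0,t]` only grows for `t > t₀`.
  have hblock : ∀ k : ℤ, ∃ (P : J b → ℝ≥0∞) (s : Set (J b)), IsTest P ∧ ∫⁻ t, P t ∂B ≤ 1 ∧
      MeasurableSet s ∧ s ⊆ levelBlock v k ∧ γ (levelBlock v k) ≤ 2 * γ s ∧
      ∀ t ∈ s, (2 ^ (k : ℝ) * C₀⁻¹) ^ r ≤ ∫⁻ x in Iic t, P x ^ (r / p) ∂N := by
    intro k
    by_cases h0 : γ (levelBlock v k) = 0
    · exact ⟨fun _ => 0, ∅, IsTest.zero, by simp, MeasurableSet.empty, empty_subset _,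
        by simp [h0], by simp⟩
    have hfk : γ (levelBlock v k) ≠ ∞ :=
      ne_top_of_le_ne_top (hfin k) (measure_mono inter_subset_left)
    obtain ⟨t₀, ht₀, hγt₀⟩ : ∃ t₀, 2 ^ (k : ℝ) < v t₀ ∧
        γ (levelBlock v k) / 2 < γ (Ioi t₀ ∩ levelBlock v k) := by
      by_contra! hcon
      have h1 := measure_le_of_isUpperSet_of_nullSingleton (γ.restrict (levelBlock v k))
        (isUpperSet_lt hvm (2 ^ (k : ℝ))) (c := γ (levelBlock v k) / 2) fun t ht => by
          rw [Measure.restrict_apply measurableSet_Ioi]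
          exact hcon t ht
      rw [Measure.restrict_apply (measurableSet_lt_of_monotone hvm _),
        inter_eq_self_of_subset_right
          (show levelBlock v k ⊆ {t | 2 ^ (k : ℝ) < v t} from inter_subset_left)] at h1
      exact absurd h1 (not_le.2 (ENNReal.half_lt_self h0 hfk))
    -- If no such function existed, the necessity part of the embedding theorem would give `v t₀ ≤
    -- 2^k`.
    obtain ⟨P, hP, hP1, hPt⟩ : ∃ P : J b → ℝ≥0∞, IsTest P ∧ ∫⁻ t, P t ∂B ≤ 1 ∧
        (2 ^ (k : ℝ) * C₀⁻¹) ^ r < ∫⁻ x in Iic t₀, P x ^ (r / p) ∂N := by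
      by_contra! hcon
      have h1 := hV b B ω (N.restrict (Iic t₀)) hω (2 ^ (k : ℝ) * C₀⁻¹) hcon
      rw [mul_left_comm, ENNReal.mul_inv_cancel hC₀0 hC₀, mul_one] at h1
      exact absurd h1 (not_le.2 ht₀)
    refine ⟨P, Ioi t₀ ∩ levelBlock v k, hP, hP1,
      measurableSet_Ioi.inter (measurableSet_levelBlock hvm k), inter_subset_right, ?_,
      fun t ht => hPt.le.trans ?_⟩
    · rw [mul_comm]
      exact (ENNReal.div_le_iff_le_mul (by simp) (by simp)).1 hγt₀.le
    · gcongr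
      exact le_of_lt ht.1
  choose P s hP hP1 hsm hsb hγs hPs using hblock
  have hyD : multNorm p q y ≤ D * H := by
    refine multNorm_le_of_finset hp hq y fun S a ha haS => ?_
    -- Test functions stand for `p`-th powers of `g`, so their `B`-integrals add and `∑ a_k^p ≤ 1`
    -- normalises the superposition. In `D`, the factor `2^(1/q)` pays for halving and `C₀` for near
    -- extremality.
    set T : J b → ℝ≥0∞ := fun t => ∑ k ∈ S, a k ^ p * P k t with hT
    have hTtest : IsTest T :=
      IsTest.sum S hP fun k => ENNReal.rpow_ne_top_of_nonneg hp.le (ha k)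
    have hT1 : ∫⁻ t, T t ∂B ≤ 1 := by
      rw [lintegral_finsetSum _ fun k _ => ((hP k).anti.measurable).const_mul _]
      refine le_trans (Finset.sum_le_sum fun k _ => ?_) haS
      rw [lintegral_const_mul _ (hP k).anti.measurable]
      exact mul_le_of_le_one_right zero_le (hP1 k)
    have hmain := hH T hTtest hT1
    have hlow : ∑ k ∈ S, (a k * (2 ^ (k : ℝ) * C₀⁻¹)) ^ q * γ (s k) ≤
        ∫⁻ t, (∫⁻ x in Iic t, T x ^ (r / p) ∂N) ^ (q / r) ∂γ := by
      calc ∑ k ∈ S, (a k * (2 ^ (k : ℝ) * C₀⁻¹)) ^ q * γ (s k)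
          ≤ ∑ k ∈ S, ∫⁻ t in s k, (∫⁻ x in Iic t, T x ^ (r / p) ∂N) ^ (q / r) ∂γ := by
            refine Finset.sum_le_sum fun k hk => ?_
            rw [← setLIntegral_const]
            refine setLIntegral_mono' (hsm k) fun t ht => ?_
            have hTk : ∀ x, a k ^ r * P k x ^ (r / p) ≤ T x ^ (r / p) := by
              intro x
              have h1 : a k ^ p * P k x ≤ T x :=
                Finset.single_le_sum (f := fun k => a k ^ p * P k x) (fun _ _ => zero_le) hk
              refine le_trans (le_of_eq ?_) (ENNReal.rpow_le_rpow h1 (by positivity : 0 ≤ r / p))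
              rw [ENNReal.mul_rpow_of_nonneg _ _ (by positivity), ← ENNReal.rpow_mul,
                mul_div_cancel₀ _ hp.ne']
            calc (a k * (2 ^ (k : ℝ) * C₀⁻¹)) ^ q
                = (a k ^ r * (2 ^ (k : ℝ) * C₀⁻¹) ^ r) ^ (q / r) := by
                  rw [← ENNReal.mul_rpow_of_nonneg _ _ hr.le, ← ENNReal.rpow_mul,
                    mul_div_cancel₀ _ hr.ne']
              _ ≤ (a k ^ r * ∫⁻ x in Iic t, P k x ^ (r / p) ∂N) ^ (q / r) := by
                  gcongr
                  exact hPs k t ht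
              _ ≤ _ := by
                  gcongr
                  rw [← lintegral_const_mul _ ((hP k).anti.measurable.pow_const _)]
                  exact lintegral_mono fun x => hTk x
        _ = ∫⁻ t in ⋃ k ∈ S, s k, (∫⁻ x in Iic t, T x ^ (r / p) ∂N) ^ (q / r) ∂γ := by
            rw [lintegral_biUnion_finset (fun i _ j _ hij =>
              (levelBlock_disjoint v hij).mono (hsb i) (hsb j)) fun k _ => hsm k]
        _ ≤ _ := setLIntegral_le_lintegral _ _
    calc ∑ k ∈ S, (y k * a k) ^ q
        ≤ ∑ k ∈ S, 2 * C₀ ^ q * ((a k * (2 ^ (k : ℝ) * C₀⁻¹)) ^ q * γ (s k)) := by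
          refine Finset.sum_le_sum fun k _ => ?_
          have hcc : C₀ ^ q * (C₀⁻¹) ^ q = 1 := by
            rw [← ENNReal.mul_rpow_of_nonneg _ _ hq.le, ENNReal.mul_inv_cancel hC₀0 hC₀,
              ENNReal.one_rpow]
          calc (y k * a k) ^ q = a k ^ q * 2 ^ (k * q) * γ (levelBlock v k) := by
                rw [ENNReal.mul_rpow_of_nonneg _ _ hq.le, hyq]; ring
            _ ≤ a k ^ q * 2 ^ (k * q) * (2 * γ (s k)) := by gcongr; exact hγs k
            _ = a k ^ q * 2 ^ (k * q) * (2 * γ (s k)) * (C₀ ^ q * (C₀⁻¹) ^ q) := by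
                rw [hcc, mul_one]
            _ = _ := by
                rw [ENNReal.mul_rpow_of_nonneg _ _ hq.le, ENNReal.mul_rpow_of_nonneg _ _ hq.le,
                  ← ENNReal.rpow_mul]
                ring
      _ = 2 * C₀ ^ q * ∑ k ∈ S, (a k * (2 ^ (k : ℝ) * C₀⁻¹)) ^ q * γ (s k) := by
          rw [Finset.mul_sum]
      _ ≤ 2 * C₀ ^ q * H ^ q := by gcongr; exact hlow.trans hmain
      _ = (D * H) ^ q := by
          rw [ENNReal.mul_rpow_of_nonneg _ _ hq.le, hD, ENNReal.mul_rpow_of_nonneg _ _ hq.le,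
            rpow_one_div_rpow _ hq]
  calc levelConst p q v γ ≤ C₁ * (D * H) := hcy.trans (by gcongr)
    _ = C₁ * D * H := (mul_assoc _ _ _).symm
    _ ≤ _ := by
        gcongr
        rw [add_assoc]
        exact le_self_add

/-! ### Left continuity of the embedding constants -/

theorem iSup_rpow {ι : Type*} (x : ι → ℝ≥0∞) {a : ℝ} (ha : 0 < a) :
    (⨆ i, x i) ^ a = ⨆ i, x i ^ a :=
  (ENNReal.monotone_rpow_of_nonneg ha.le).map_iSup_of_continuousAt
    ENNReal.continuous_rpow_const.continuousAt (by simp [ha])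

theorem measurable_measure_Iic (U : Measure (J b)) : Measurable fun t => U (Iic t) :=
  Monotone.measurable fun _ _ h => measure_mono (Iic_subset_Iic.2 h)

theorem embConst_le_iSup {p r : ℝ} (hp : 0 < p) (hr : 0 < r) (ω : J b → ℝ≥0∞) {U : Measure (J b)}
    {U' : ℕ → Measure (J b)} (hU' : Monotone U') (h : ∀ x, U (Iic x) ≤ ⨆ n, U' n (Iic x)) :
    embConst p r ω U ≤ ⨆ n, embConst p r ω (U' n) := by
  have key : ∀ a : ℝ, 0 < a → ∀ x, U (Iic x) ^ a ≤ ⨆ n, U' n (Iic x) ^ a := fun a ha x => by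
    rw [← iSup_rpow _ ha]
    exact ENNReal.rpow_le_rpow (h x) ha.le
  by_cases hpr : p ≤ r
  · simp only [embConst, if_pos hpr]
    rw [iSup_comm]
    refine iSup_mono fun x => ?_
    rw [← ENNReal.iSup_mul]
    gcongr
    exact key _ (by positivity) x
  · have hs : 0 < p * r / (p - r) := div_pos (mul_pos hp hr) (by linarith)
    simp only [embConst, if_neg hpr]
    rw [← iSup_rpow _ (by positivity)]
    refine ENNReal.rpow_le_rpow ?_ (by positivity)
    rw [← lintegral_iSup (fun n => (measurable_measure_Iic _).pow_const _)]
    · exact lintegral_mono fun x => key _ (by positivity) x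
    · intro m n hmn x
      exact ENNReal.rpow_le_rpow (hU' hmn _) (by positivity)

/-- Since `N` has no atom at `t`, its restriction to `(0,t]` is the increasing limit of the
restrictions to `(0,x n]` with `x n` increasing to `t`, and `embConst` passes to the limit by
monotone convergence. -/
theorem exists_lt_initConst {p r : ℝ} (hp : 0 < p) (hr : 0 < r) (ω : J b → ℝ≥0∞)
    (N : Measure (J b)) [NullSingletonClass N] (t : J b) (c : ℝ≥0∞) (h : c < initConst p r ω N t) :
    ∃ t' < t, c < initConst p r ω N t' := by
  obtain ⟨x, hx, hxt, hxc⟩ := exists_monotone_seq_of_isLowerSet (isLowerSet_Iio t)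
    (nonempty_Iio (a := t))
  have hmono : Monotone fun n => N.restrict (Iic (x n)) := fun m n hmn =>
    Measure.restrict_mono (Iic_subset_Iic.2 (hx hmn)) le_rfl
  have hle : initConst p r ω N t ≤ ⨆ n, initConst p r ω N (x n) := by
    refine embConst_le_iSup hp hr ω hmono fun y => ?_
    rw [Measure.restrict_apply measurableSet_Iic, inter_comm,
      ← Measure.restrict_apply measurableSet_Iic,
      ← measure_congr (Iio_ae_eq_Iic (μ := N.restrict (Iic y)) (a := t))]
    refine measure_le_of_isLowerSet _ (isLowerSet_Iio t) fun s hs => ?_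
    obtain ⟨n, hn⟩ := hxc s hs
    refine le_trans ?_ (le_iSup _ n)
    rw [Measure.restrict_apply measurableSet_Iic, Measure.restrict_apply measurableSet_Iic,
      inter_comm]
    gcongr
  obtain ⟨n, hn⟩ := lt_iSup_iff.1 (h.trans_le hle)
  exact ⟨x n, hxt n, hn⟩

/-! ### Passage from the cone to nonincreasing functions -/

/-- The measure `k ^ p dβ`. -/
def powMeasure (p : ℝ) (k : J b → ℝ) (β : Measure (J b)) : Measure (J b) :=
  β.withDensity fun t => ENNReal.ofReal (k t) ^ p

section transfer

variable {p q r : ℝ} {k : J b → ℝ} {β γ μ : Measure (J b)}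

theorem powMeasure_apply {S : Set (J b)} (hS : MeasurableSet S) :
    powMeasure p k β S = ∫⁻ t in S, ENNReal.ofReal (k t) ^ p ∂β := withDensity_apply _ hS

instance nullSingletonClass_powMeasure [NullSingletonClass μ] :
    NullSingletonClass (powMeasure r k μ) :=
  ⟨fun x => withDensity_absolutelyContinuous _ _ (measure_singleton x)⟩

theorem MemN.isWeight [NullSingletonClass β] (hp : 0 < p) (h : MemN p k β) :
    IsWeight p (powMeasure p k β) (omega p k β) where
  measure_Iic t := by
    rw [powMeasure_apply measurableSet_Iic, omega, rpow_one_div_rpow _ hp]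
    exact setLIntegral_congr Iio_ae_eq_Iic.symm
  pos := h.pos
  lt_top := h.lt_top
  cont := h.cont
  zero := h.zero
  top := h.top

theorem Psi_eq (t : J b) : Psi r k μ t = powMeasure r k μ (Iic t) ^ (1 / r) := by
  rw [Psi, powMeasure_apply measurableSet_Iic]

theorem Psi_rpow (t : J b) (a : ℝ) :
    Psi r k μ t ^ a = powMeasure r k μ (Iic t) ^ (a / r) := by
  rw [Psi_eq, ← ENNReal.rpow_mul, one_div_mul_eq_div]

theorem lintegral_powMeasure (hk : Continuous k) {g : J b → ℝ≥0∞} (hg : Measurable g)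
    {S : Set (J b)} (hS : MeasurableSet S) :
    ∫⁻ t in S, g t ∂(powMeasure p k β) = ∫⁻ t in S, ENNReal.ofReal (k t) ^ p * g t ∂β :=
  setLIntegral_withDensity_eq_setLIntegral_mul β
    ((ENNReal.measurable_ofReal.comp hk.measurable).pow_const p) hg hS

/-- For `N` restricted to `(0,t]` the mass of `(0,x]` is `N(0, min x t]`. For `p > r` it is constant
on `x > t`, where `-d[ω^(-σ)]` has total mass `ω(t)^(-σ)`: this is the second term in `V`. -/
theorem V_eq_initConst [NullSingletonClass β] (hp : 0 < p) (hr : 0 < r) (h : MemN p k β) :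
    V p r k β μ = initConst p r (omega p k β) (powMeasure r k μ) := by
  have hω := h.isWeight hp
  set N := powMeasure r k μ with hN
  ext t
  have hres : ∀ x, N.restrict (Iic t) (Iic x) = N (Iic (min x t)) := fun x => by
    rw [Measure.restrict_apply measurableSet_Iic, Iic_inter_Iic]
  by_cases hpr : p ≤ r
  · simp only [V, initConst, embConst, if_pos hpr, hres, Psi_eq, ← hN]
    refine le_antisymm (iSup₂_le fun x hx => ?_) (iSup_le fun x => ?_)
    · refine le_trans (le_of_eq ?_) (le_iSup _ x)
      rw [min_eq_left (mem_Iic.1 hx)]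
    · refine le_trans ?_ (le_iSup₂ (f := fun τ (_ : τ ∈ Iic t) =>
        N (Iic τ) ^ (1 / r) * (omega p k β τ)⁻¹) (min x t) (mem_Iic.2 (min_le_right x t)))
      gcongr
      exact hω.monotone hp (min_le_left _ _)
  · have hs : 0 < p * r / (p - r) := div_pos (mul_pos hp hr) (by linarith)
    simp only [V, initConst, embConst, if_neg hpr, hres, Psi_rpow, ← hN]
    set s := p * r / (p - r)
    set l := negStieltjes fun x => omega p k β x ^ (-s) with hl
    congr 1
    rw [← lintegral_add_compl (μ := l) (fun x => N (Iic (min x t)) ^ (s / r))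
      (measurableSet_Iic (a := t)), compl_Iic]
    congr 1
    · refine setLIntegral_congr_fun measurableSet_Iic fun x hx => ?_
      simp only [min_eq_left (mem_Iic.1 hx)]
    · have : ∫⁻ x in Ioi t, N (Iic (min x t)) ^ (s / r) ∂l =
          ∫⁻ x in Ioi t, N (Iic t) ^ (s / r) ∂l :=
        setLIntegral_congr_fun measurableSet_Ioi fun x hx => by
          simp only [min_eq_right (le_of_lt (mem_Ioi.1 hx))]
      rw [this, setLIntegral_const, hl, hω.negStieltjes_Ioi hp hs,
        ENNReal.mul_rpow_of_nonneg _ _ hs.le, Psi_rpow, ENNReal.inv_rpow, ENNReal.rpow_neg]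

theorem constE_eq_embConst : constE p q r k β γ μ =
    embConst p q (omega p k β) (γ.withDensity fun t => powMeasure r k μ (Iic t) ^ (q / r)) := by
  simp only [constE, embConst, withDensity_apply _ measurableSet_Iic, Psi_rpow]

theorem constF_eq_tailConst [NullSingletonClass β] (hp : 0 < p) (hr : 0 < r) (h : MemN p k β) :
    constF p q r k β γ μ =
      tailConst p q (initConst p r (omega p k β) (powMeasure r k μ)) γ := by
  simp only [constF, tailConst, V_eq_initConst hp hr h]

theorem antitone_ofReal_div {f : J b → ℝ} (hf : f ∈ cone p k β) :
    Antitone fun t => ENNReal.ofReal (f t / k t) := fun _ _ h =>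
  ENNReal.ofReal_le_ofReal (hf.2.1 h)

theorem ofReal_mul_ofReal_div (hk : ∀ t, 0 < k t) (f : J b → ℝ) (a : ℝ) (ha : 0 ≤ a) (t : J b) :
    ENNReal.ofReal (k t) ^ a * ENNReal.ofReal (f t / k t) ^ a = ENNReal.ofReal (f t) ^ a := by
  rw [← ENNReal.mul_rpow_of_nonneg _ _ ha, ← ENNReal.ofReal_mul (hk t).le,
    mul_div_cancel₀ _ (hk t).ne']

theorem lintegral_cone_eq (hkc : Continuous k) (hk : ∀ t, 0 < k t) (hp : 0 ≤ p) {f : J b → ℝ}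
    (hf : Antitone fun t => ENNReal.ofReal (f t / k t)) :
    ∫⁻ t, ENNReal.ofReal (f t) ^ p ∂β =
      ∫⁻ t, ENNReal.ofReal (f t / k t) ^ p ∂(powMeasure p k β) := by
  rw [← setLIntegral_univ, ← setLIntegral_univ (μ := powMeasure p k β),
    lintegral_powMeasure hkc (hf.measurable.pow_const p) MeasurableSet.univ]
  simp_rw [ofReal_mul_ofReal_div hk f p hp]

theorem hardy_rpow_eq (hkc : Continuous k) (hk : ∀ t, 0 < k t) (hr : 0 < r) {f : J b → ℝ}
    (hf : Antitone fun t => ENNReal.ofReal (f t / k t)) (t : J b) :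
    hardy r μ f t ^ q =
      (∫⁻ x in Iic t, ENNReal.ofReal (f x / k x) ^ r ∂(powMeasure r k μ)) ^ (q / r) := by
  rw [lintegral_powMeasure hkc (hf.measurable.pow_const r) measurableSet_Iic, hardy,
    ← ENNReal.rpow_mul, one_div_mul_eq_div]
  simp_rw [ofReal_mul_ofReal_div hk f r hr.le]

theorem coneNorm_le (hkc : Continuous k) (hk : ∀ t, 0 < k t) (hp : 0 < p) (hr : 0 < r) {H : ℝ≥0∞}
    (h : ∀ g : J b → ℝ≥0∞, Antitone g → (∀ t, g t ≠ ∞) →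
      (∫⁻ t, (∫⁻ x in Iic t, g x ^ r ∂(powMeasure r k μ)) ^ (q / r) ∂γ) ^ (1 / q) ≤
        H * (∫⁻ t, g t ^ p ∂(powMeasure p k β)) ^ (1 / p)) :
    coneNorm p q r k β γ μ ≤ H := by
  refine iSup₂_le fun f hf => ?_
  have hg := antitone_ofReal_div hf
  simp_rw [hardy_rpow_eq hkc hk hr hg, lintegral_cone_eq hkc hk hp.le hg]
  rw [ENNReal.rpow_neg]
  set X := (∫⁻ t, ENNReal.ofReal (f t / k t) ^ p ∂(powMeasure p k β)) ^ (1 / p)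
  calc _ ≤ H * X * X⁻¹ := by
        gcongr
        exact h _ hg fun _ => ENNReal.ofReal_ne_top
    _ ≤ H := by
        rw [mul_assoc]
        exact mul_le_of_le_one_right zero_le (ENNReal.mul_inv_le_one _)

/-- The competitor is `f = k P^(1/p)`, left-continuous because `k` is continuous and `P` is
left-continuous. -/
theorem le_coneNorm (hkc : Continuous k) (hk : ∀ t, 0 < k t) (hp : 0 < p) (hr : 0 < r)
    {P : J b → ℝ≥0∞} (hP : IsTest P) (hP1 : ∫⁻ t, P t ∂(powMeasure p k β) ≠ ∞) :
    (∫⁻ t, (∫⁻ x in Iic t, P x ^ (r / p) ∂(powMeasure r k μ)) ^ (q / r) ∂γ) ^ (1 / q) *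
      (∫⁻ t, P t ∂(powMeasure p k β)) ^ (-(1 / p)) ≤ coneNorm p q r k β γ μ := by
  have hPt : ∀ t, P t ^ (1 / p) ≠ ∞ := fun t =>
    ENNReal.rpow_ne_top_of_nonneg (by positivity) (hP.ne_top t)
  set f : J b → ℝ := fun t => k t * (P t ^ (1 / p)).toReal with hf
  have hdiv : ∀ t, f t / k t = (P t ^ (1 / p)).toReal := fun t =>
    mul_div_cancel_left₀ _ (hk t).ne'
  have hofReal : ∀ t, ENNReal.ofReal (f t / k t) = P t ^ (1 / p) := fun t => by
    rw [hdiv, ENNReal.ofReal_toReal (hPt t)]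
  have hanti : Antitone fun t => ENNReal.ofReal (f t / k t) := by
    simp_rw [hofReal]
    exact antitone_rpow hP.anti (by positivity)
  have hpow : ∀ a t, ENNReal.ofReal (f t / k t) ^ a = P t ^ (a / p) := fun a t => by
    rw [hofReal, ← ENNReal.rpow_mul, one_div_mul_eq_div]
  have hint : ∫⁻ t, ENNReal.ofReal (f t) ^ p ∂β = ∫⁻ t, P t ∂(powMeasure p k β) := by
    rw [lintegral_cone_eq hkc hk hp.le hanti]
    simp_rw [hpow, div_self hp.ne', ENNReal.rpow_one]
  have hfc : f ∈ cone p k β := by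
    refine ⟨fun t => mul_nonneg (hk t).le ENNReal.toReal_nonneg, fun s t hst => ?_, fun t => ?_, ?_⟩
    · simp only [hdiv]
      exact ENNReal.toReal_mono (hPt s) (antitone_rpow hP.anti (by positivity) hst)
    · refine hkc.continuousWithinAt.mul ?_
      exact (ENNReal.tendsto_toReal (hPt t)).comp
        ((ENNReal.continuous_rpow_const.tendsto _).comp (hP.leftCont t))
    · rw [hint]; exact lt_top_iff_ne_top.2 hP1
  refine le_trans (le_of_eq ?_) (le_iSup₂ f hfc)
  rw [hint]
  simp_rw [hardy_rpow_eq hkc hk hr hanti, hpow]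

theorem isHardyBound_coneNorm (hkc : Continuous k) (hk : ∀ t, 0 < k t) (hp : 0 < p) (hq : 0 < q)
    (hr : 0 < r) :
    IsHardyBound p q r (powMeasure p k β) (powMeasure r k μ) γ (coneNorm p q r k β γ μ) := by
  intro P hP hP1
  have h1 := le_coneNorm (q := q) (γ := γ) (μ := μ) hkc hk hp hr hP
    (ne_top_of_le_ne_top ENNReal.one_ne_top hP1)
  rw [← ENNReal.rpow_inv_le_iff hq, ← one_div]
  refine le_trans ?_ h1
  refine le_mul_of_one_le_right zero_le ?_
  rw [ENNReal.rpow_neg, ENNReal.one_le_inv]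
  exact ENNReal.rpow_le_one hP1 (by positivity)

end transfer

/-! ### The sharp constant for `p ≤ min q r` -/

/-- A nonincreasing function is approximated from below, up to a factor close to `1`, by
nonnegative combinations of indicators of initial intervals. -/
theorem exists_step_approx {P : J b → ℝ≥0∞} (hP : Antitone P) (hPt : ∀ t, P t ≠ ∞) {a : ℝ≥0∞}
    (ha0 : a ≠ 0) (ha1 : a < 1) :
    ∃ (w : ℕ → ℝ≥0∞) (T : ℕ → Set (J b)), (∀ n, w n ≠ ∞) ∧ (∀ n, IsLowerSet (T n)) ∧
      ∀ t, a * P t ≤ ∑' n, (T n).indicator (fun _ => w n) t ∧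
        ∑' n, (T n).indicator (fun _ => w n) t ≤ P t := by
  have hat : a ≠ ∞ := (ha1.trans ENNReal.one_lt_top).ne
  have hρ0 : a⁻¹ ≠ 0 := ENNReal.inv_ne_zero.2 hat
  have hρt : a⁻¹ ≠ ∞ := ENNReal.inv_ne_top.2 ha0
  have hρ1 : 1 < a⁻¹ := ENNReal.one_lt_inv.2 ha1
  -- The weights with index `j ≤ n` sum to exactly `a⁻¹ ^ n`, so the step function is `P` rounded
  -- down to an integer power of `a⁻¹`.
  set w : ℤ → ℝ≥0∞ := fun j => a⁻¹ ^ j * (1 - a) with hw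
  set T : ℤ → Set (J b) := fun j => {t | a⁻¹ ^ j ≤ P t} with hT
  set e : ℕ ≃ ℤ := (Denumerable.eqv ℤ).symm
  refine ⟨fun n => w (e n), fun n => T (e n), fun n => ENNReal.mul_ne_top
    (ENNReal.zpow_ne_top hρ0 hρt _) (ENNReal.sub_ne_top ENNReal.one_ne_top),
    fun n s t hts hs => le_trans hs (hP hts), fun t => ?_⟩
  rw [e.tsum_eq (fun j => (T j).indicator (fun _ => w j) t)]
  rcases eq_or_ne (P t) 0 with h0 | h0
  · have : ∀ j, (T j).indicator (fun _ => w j) t = 0 := fun j => by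
      refine indicator_of_notMem ?_ _
      simp only [hT, mem_ofPred_eq, not_le, h0]
      exact ENNReal.zpow_pos hρ0 hρt j
    simp [this, h0]
  obtain ⟨n, hn, hn'⟩ := ENNReal.exists_mem_Ico_zpow h0 (hPt t) hρ1 hρt
  have hsum : ∑' j, (T j).indicator (fun _ => w j) t = a⁻¹ ^ n := by
    rw [tsum_int_eq_tsum_nat (n := n)]
    · have hd : ∀ d : ℕ, (T (n - d)).indicator (fun _ => w (n - d)) t =
          a⁻¹ ^ n * (1 - a) * a ^ d := by
        intro d
        have hz : a⁻¹ ^ (n - (d : ℤ)) = a⁻¹ ^ n * a ^ d := by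
          rw [sub_eq_add_neg, ENNReal.zpow_add hρ0 hρt, ENNReal.zpow_neg, zpow_natCast,
            ENNReal.inv_pow, inv_inv]
        rw [indicator_of_mem]
        · simp only [hw]
          rw [hz]; ring
        · exact (ENNReal.zpow_le_of_le hρ1.le (by omega)).trans hn
      simp_rw [hd]
      rw [ENNReal.tsum_mul_left, ENNReal.tsum_geometric, mul_assoc,
        ENNReal.mul_inv_cancel (tsub_pos_of_lt ha1).ne' (ENNReal.sub_ne_top ENNReal.one_ne_top),
        mul_one]
    · intro j hj
      refine indicator_of_notMem ?_ _
      simp only [hT, mem_ofPred_eq, not_le]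
      exact hn'.trans_le (ENNReal.zpow_le_of_le hρ1.le hj)
  rw [hsum]
  refine ⟨?_, hn⟩
  calc a * P t ≤ a * a⁻¹ ^ (n + 1) := by gcongr
    _ = a⁻¹ ^ n := by
      rw [ENNReal.zpow_add hρ0 hρt, zpow_one, mul_left_comm, ENNReal.mul_inv_cancel ha0 hat,
        mul_one]

section sharp

variable {p q r : ℝ} {k : J b → ℝ} {β γ μ : Measure (J b)}

theorem lintegral_Psi_le (hq : 0 < q) (h : MemN p k β) (t : J b) :
    ∫⁻ τ, Psi r k μ (min t τ) ^ q ∂γ ≤ (constJ p q r k β γ μ * omega p k β t) ^ q := by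
  rw [← ENNReal.rpow_inv_le_iff hq, ← one_div]
  have h1 : (∫⁻ τ, Psi r k μ (min t τ) ^ q ∂γ) ^ (1 / q) * (omega p k β t)⁻¹ ≤
      constJ p q r k β γ μ :=
    le_iSup (fun t => (∫⁻ τ, Psi r k μ (min t τ) ^ q ∂γ) ^ (1 / q) * (omega p k β t)⁻¹) t
  rwa [← div_eq_mul_inv, ENNReal.div_le_iff (h.pos t).ne' (h.lt_top t).ne] at h1

/-- For `T = (0,x]` this is the definition of `constJ`. The level sets of `g` need not be of this
form, but they are increasing unions of such intervals. -/
theorem lintegral_measure_inter_Iic_le [NullSingletonClass β] (hp : 0 < p) (hq : 0 < q)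
    (hr : 0 < r) (h : MemN p k β) {T : Set (J b)} (hT : IsLowerSet T) :
    (∫⁻ t, powMeasure r k μ (T ∩ Iic t) ^ (q / r) ∂γ) ^ (p / q) ≤
      constJ p q r k β γ μ ^ p * powMeasure p k β T := by
  rcases T.eq_empty_or_nonempty with rfl | hne
  · simp [div_pos hq hr, div_pos hp hq]
  obtain ⟨x, hx, hxT, hxc⟩ := exists_monotone_seq_of_isLowerSet hT hne
  have hTx : T = ⋃ n, Iic (x n) := by
    refine Subset.antisymm (fun y hy => mem_iUnion.2 (hxc y hy)) ?_
    exact iUnion_subset fun n y hy => hT hy (hxT n)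
  have hmono : Monotone fun n => fun t => powMeasure r k μ (Iic (x n) ∩ Iic t) ^ (q / r) :=
    fun m n hmn t => by
      dsimp only
      gcongr
      exact hx hmn
  have hsup : ∀ t, powMeasure r k μ (T ∩ Iic t) ^ (q / r) =
      ⨆ n, powMeasure r k μ (Iic (x n) ∩ Iic t) ^ (q / r) := fun t => by
    rw [← iSup_rpow _ (by positivity), hTx, iUnion_inter, Monotone.measure_iUnion]
    exact fun m n hmn => inter_subset_inter_left _ (Iic_subset_Iic.2 (hx hmn))
  simp_rw [hsup]
  rw [lintegral_iSup (fun n => ?_) hmono]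
  · rw [iSup_rpow _ (by positivity)]
    refine iSup_le fun n => ?_
    have h1 : ∫⁻ t, powMeasure r k μ (Iic (x n) ∩ Iic t) ^ (q / r) ∂γ ≤
        (constJ p q r k β γ μ * omega p k β (x n)) ^ q := by
      refine le_trans (le_of_eq (lintegral_congr fun t => ?_)) (lintegral_Psi_le hq h (x n))
      rw [Psi_rpow, Iic_inter_Iic]
    calc _ ≤ ((constJ p q r k β γ μ * omega p k β (x n)) ^ q) ^ (p / q) := by gcongr
      _ = constJ p q r k β γ μ ^ p * powMeasure p k β (Iic (x n)) := by
          rw [← ENNReal.rpow_mul, mul_div_cancel₀ _ hq.ne', ENNReal.mul_rpow_of_nonneg _ _ hp.le,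
            (h.isWeight hp).measure_Iic]
      _ ≤ _ := by
          gcongr
          exact fun y hy => hT hy (hxT n)
  · refine Measurable.pow_const (Monotone.measurable fun s t hst => ?_) _
    exact measure_mono (inter_subset_inter_right _ (Iic_subset_Iic.2 hst))

/-- Because `r/p ≥ 1` and `q/p ≥ 1`, the `p`-th power of the left side is subadditive in `g^p`,
whereas the right side is additive. So the inequality for indicators of lower sets passes to step
functions, and the rounding loss `a` tends to `1`. -/
theorem coneNorm_le_constJ [NullSingletonClass β] (hkc : Continuous k) (hk : ∀ t, 0 < k t)
    (hp : 0 < p) (hq : 0 < q) (hr : 0 < r) (hpq : p ≤ q) (hpr : p ≤ r) (h : MemN p k β) :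
    coneNorm p q r k β γ μ ≤ constJ p q r k β γ μ := by
  refine coneNorm_le hkc hk hp hr fun g hg hgt => ?_
  set N := powMeasure r k μ with hN
  set B := powMeasure p k β with hB
  have hθ : 1 ≤ r / p := (one_le_div hp).2 hpr
  have hκ : 1 ≤ q / p := (one_le_div hp).2 hpq
  have hPa : Antitone fun t => g t ^ p := antitone_rpow hg hp.le
  suffices hmain : (∫⁻ t, (∫⁻ x in Iic t, g x ^ r ∂N) ^ (q / r) ∂γ) ^ (p / q) ≤
      constJ p q r k β γ μ ^ p * ∫⁻ t, g t ^ p ∂B by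
    have h1 := ENNReal.rpow_le_rpow hmain (by positivity : 0 ≤ 1 / p)
    rwa [← ENNReal.rpow_mul, ENNReal.mul_rpow_of_nonneg _ _ (by positivity),
      rpow_rpow_one_div _ hp, show p / q * (1 / p) = 1 / q by field_simp] at h1
  refine ENNReal.le_of_forall_lt_one_mul_le fun a ha1 => ?_
  rcases eq_or_ne a 0 with rfl | ha0
  · simp
  have hat : a ≠ ∞ := (ha1.trans ENNReal.one_lt_top).ne
  obtain ⟨w, T, hwt, hT, hstep⟩ := exists_step_approx hPa
    (fun t => ENNReal.rpow_ne_top_of_nonneg hp.le (hgt t)) ha0 ha1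
  have hTm : ∀ n, MeasurableSet (T n) := fun n => (hT n).ordConnected.measurableSet
  have hind : ∀ (θ : ℝ), 0 < θ → ∀ n, (fun x => (T n).indicator (fun _ => w n) x ^ θ) =
      (T n).indicator fun _ => w n ^ θ := by
    intro θ hθ n
    ext x
    by_cases hx : x ∈ T n <;> simp [hx, hθ]
  have hinner : ∀ t, a * (∫⁻ x in Iic t, g x ^ r ∂N) ^ (p / r) ≤
      ∑' n, w n * N (T n ∩ Iic t) ^ (p / r) := by
    intro t
    have hpr' : p / r = 1 / (r / p) := by field_simp
    calc a * (∫⁻ x in Iic t, g x ^ r ∂N) ^ (p / r)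
        = (∫⁻ x in Iic t, (a * g x ^ p) ^ (r / p) ∂N) ^ (1 / (r / p)) := by
          have : ∀ x, (a * g x ^ p) ^ (r / p) = a ^ (r / p) * g x ^ r := fun x => by
            rw [ENNReal.mul_rpow_of_nonneg _ _ (by positivity), ← ENNReal.rpow_mul,
              mul_div_cancel₀ _ hp.ne']
          simp_rw [this]
          rw [lintegral_const_mul' _ _ (ENNReal.rpow_ne_top_of_nonneg (by positivity) hat),
            ENNReal.mul_rpow_of_nonneg _ _ (by positivity), rpow_rpow_one_div _ (by positivity),
            hpr']
      _ ≤ (∫⁻ x in Iic t, (∑' n, (T n).indicator (fun _ => w n) x) ^ (r / p) ∂N) ^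
            (1 / (r / p)) := by
          gcongr with x
          exact (hstep x).1
      _ ≤ ∑' n, (∫⁻ x in Iic t, (T n).indicator (fun _ => w n) x ^ (r / p) ∂N) ^
            (1 / (r / p)) :=
          lintegral_Lp_tsum_le _ (fun n => measurable_const.indicator (hTm n)) hθ
      _ = _ := by
          refine tsum_congr fun n => ?_
          rw [hind _ (by positivity), lintegral_indicator_const (hTm n),
            Measure.restrict_apply (hTm n), ENNReal.mul_rpow_of_nonneg _ _ (by positivity),
            rpow_rpow_one_div _ (by positivity), hpr']
  have hNT : ∀ n, Measurable fun t => N (T n ∩ Iic t) := fun n =>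
    Monotone.measurable fun s t hst =>
      measure_mono (inter_subset_inter_right _ (Iic_subset_Iic.2 hst))
  have hqp : p / q = 1 / (q / p) := by field_simp
  calc a * (∫⁻ t, (∫⁻ x in Iic t, g x ^ r ∂N) ^ (q / r) ∂γ) ^ (p / q)
      = (∫⁻ t, (a * (∫⁻ x in Iic t, g x ^ r ∂N) ^ (p / r)) ^ (q / p) ∂γ) ^ (1 / (q / p)) := by
        have : ∀ X : ℝ≥0∞, (a * X ^ (p / r)) ^ (q / p) = a ^ (q / p) * X ^ (q / r) := fun X => by
          rw [ENNReal.mul_rpow_of_nonneg _ _ (by positivity), ← ENNReal.rpow_mul]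
          congr 2; field_simp
        simp_rw [this]
        rw [lintegral_const_mul' _ _ (ENNReal.rpow_ne_top_of_nonneg (by positivity) hat),
          ENNReal.mul_rpow_of_nonneg _ _ (by positivity), rpow_rpow_one_div _ (by positivity), hqp]
    _ ≤ (∫⁻ t, (∑' n, w n * N (T n ∩ Iic t) ^ (p / r)) ^ (q / p) ∂γ) ^ (1 / (q / p)) := by
        gcongr with t
        exact hinner t
    _ ≤ ∑' n, (∫⁻ t, (w n * N (T n ∩ Iic t) ^ (p / r)) ^ (q / p) ∂γ) ^ (1 / (q / p)) :=
        lintegral_Lp_tsum_le _ (fun n => ((hNT n).pow_const _).const_mul _) hκ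
    _ = ∑' n, w n * (∫⁻ t, N (T n ∩ Iic t) ^ (q / r) ∂γ) ^ (p / q) := by
        refine tsum_congr fun n => ?_
        have : ∀ X : ℝ≥0∞, (w n * X ^ (p / r)) ^ (q / p) = w n ^ (q / p) * X ^ (q / r) :=
          fun X => by
            rw [ENNReal.mul_rpow_of_nonneg _ _ (by positivity), ← ENNReal.rpow_mul]
            congr 2; field_simp
        simp_rw [this]
        rw [lintegral_const_mul' _ _ (ENNReal.rpow_ne_top_of_nonneg (by positivity) (hwt n)),
          ENNReal.mul_rpow_of_nonneg _ _ (by positivity), rpow_rpow_one_div _ (by positivity), hqp]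
    _ ≤ ∑' n, w n * (constJ p q r k β γ μ ^ p * B (T n)) := by
        gcongr with n
        exact lintegral_measure_inter_Iic_le hp hq hr h (hT n)
    _ = constJ p q r k β γ μ ^ p * ∫⁻ t, ∑' n, (T n).indicator (fun _ => w n) t ∂B := by
        rw [lintegral_tsum fun n => (measurable_const.indicator (hTm n)).aemeasurable,
          ← ENNReal.tsum_mul_left]
        refine tsum_congr fun n => ?_
        rw [lintegral_indicator_const (hTm n), mul_left_comm]
    _ ≤ _ := by
        gcongr with t
        exact (hstep t).2

/-- The functions `k · 1_{(0,t]}` attain the quotients in `constJ`. -/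
theorem constJ_le_coneNorm [NullSingletonClass β] (hkc : Continuous k) (hk : ∀ t, 0 < k t)
    (hp : 0 < p) (hr : 0 < r) (h : MemN p k β) :
    constJ p q r k β γ μ ≤ coneNorm p q r k β γ μ := by
  have hω := h.isWeight hp
  refine iSup_le fun t => ?_
  have hint : ∫⁻ x, (Iic t).indicator (fun _ => (1 : ℝ≥0∞)) x ∂(powMeasure p k β) =
      omega p k β t ^ p := by
    rw [lintegral_indicator_const measurableSet_Iic, one_mul, hω.measure_Iic]
  refine le_trans (le_of_eq ?_) (le_coneNorm (q := q) (γ := γ) (μ := μ) hkc hk hp hr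
    (IsTest.indicator_Iic t) ?_)
  · rw [hint]
    congr 1
    · congr 1
      refine lintegral_congr fun τ => ?_
      have : (fun x => (Iic t).indicator (fun _ => (1 : ℝ≥0∞)) x ^ (r / p)) =
          (Iic t).indicator fun _ => 1 := by
        ext x
        by_cases hx : x ∈ Iic t <;> simp [hx, div_pos hr hp]
      rw [this, lintegral_indicator_const measurableSet_Iic, one_mul,
        Measure.restrict_apply measurableSet_Iic, Iic_inter_Iic, Psi_rpow]
    · rw [ENNReal.rpow_neg, rpow_rpow_one_div _ hp]
  · rw [hint]
    exact ENNReal.rpow_ne_top_of_nonneg hp.le (h.lt_top t).ne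

end sharp

/-! ### Two-sided bounds and the theorem -/

/-- The upper bound for the norm on the cone. -/
theorem exists_coneNorm_le {p q r : ℝ} (hp : 0 < p) (hq : 0 < q) (hr : 0 < r) :
    ∃ C : ℝ≥0∞, C ≠ ∞ ∧ ∀ (b : EReal) (_ : 0 < b) (k : J b → ℝ) (_ : Continuous k)
      (_ : ∀ t, 0 < k t) (β γ μ : Measure (J b)) [NullSingletonClass β] [NullSingletonClass γ]
      [NullSingletonClass μ] (_ : MemN p k β) (X : ℝ≥0∞), constE p q r k β γ μ ≤ X →
      constF p q r k β γ μ ≤ X → coneNorm p q r k β γ μ ≤ C * X := by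
  obtain ⟨C₁, hC₁, h₁⟩ := exists_hardy_le hp hq hr
  obtain ⟨C₂, hC₂, h₂⟩ := exists_levelConst_le_tailConst hp hq
  refine ⟨(C₁ * (1 + C₂ ^ q)) ^ (1 / q) + 1, ENNReal.add_ne_top.2
    ⟨ENNReal.rpow_ne_top_of_nonneg (by positivity) (ENNReal.mul_ne_top hC₁ (ENNReal.add_ne_top.2
      ⟨ENNReal.one_ne_top, ENNReal.rpow_ne_top_of_nonneg hq.le hC₂⟩)), ENNReal.one_ne_top⟩,
    fun b hb k hkc hk β γ μ _ _ _ h X hE hF => ?_⟩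
  have := nonempty_J hb
  -- The summand `1` in the constant makes it nonzero, so its product with `∞` is `∞`. For finite
  -- `X` the level constant is finite, as `exists_hardy_le` requires.
  rcases eq_or_ne X ∞ with rfl | hX
  · rw [ENNReal.mul_top (by simp)]; exact le_top
  have hω := h.isWeight hp
  rw [constE_eq_embConst] at hE
  rw [constF_eq_tailConst hp hr h] at hF
  have hL : levelConst p q (initConst p r (omega p k β) (powMeasure r k μ)) γ ≤ C₂ * X :=
    (h₂ b _ γ (initConst_mono hp hr _ _)).trans (by gcongr)
  have hLt := ne_top_of_le_ne_top (ENNReal.mul_ne_top hC₂ hX) hL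
  refine coneNorm_le hkc hk hp hr fun g hg _ => ?_
  have hmain := h₁ b _ _ (powMeasure r k μ) γ hω hLt g hg
  set G := ∫⁻ t, g t ^ p ∂(powMeasure p k β)
  calc _ ≤ (C₁ * (X ^ q + (C₂ * X) ^ q) * G ^ (q / p)) ^ (1 / q) := by
        refine ENNReal.rpow_le_rpow (hmain.trans ?_) (by positivity)
        gcongr
    _ = (C₁ * (1 + C₂ ^ q) * X ^ q * (G ^ (1 / p)) ^ q) ^ (1 / q) := by
        rw [ENNReal.mul_rpow_of_nonneg _ _ hq.le, ← ENNReal.rpow_mul, one_div_mul_eq_div]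
        congr 1; ring
    _ = (C₁ * (1 + C₂ ^ q)) ^ (1 / q) * X * G ^ (1 / p) := by
        rw [ENNReal.mul_rpow_of_nonneg _ _ (by positivity),
          ENNReal.mul_rpow_of_nonneg _ _ (by positivity), rpow_rpow_one_div _ hq,
          rpow_rpow_one_div _ hq]
    _ ≤ _ := by
        gcongr
        exact le_self_add

/-- The lower bound for the norm on the cone. -/
theorem exists_le_coneNorm {p q r : ℝ} (hp : 0 < p) (hq : 0 < q) (hr : 0 < r) :
    ∃ C : ℝ≥0∞, C ≠ ∞ ∧ ∀ (b : EReal) (_ : 0 < b) (k : J b → ℝ) (_ : Continuous k)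
      (_ : ∀ t, 0 < k t) (β γ μ : Measure (J b)) [NullSingletonClass β] [NullSingletonClass γ]
      [NullSingletonClass μ] (_ : MemN p k β),
      constE p q r k β γ μ ≤ C * coneNorm p q r k β γ μ ∧
        constF p q r k β γ μ ≤ C * coneNorm p q r k β γ μ := by
  obtain ⟨C₁, hC₁, h₁⟩ := exists_embConst_le hp hq
  obtain ⟨C₂, hC₂, h₂⟩ := exists_tailConst_le_levelConst hp hq
  obtain ⟨C₃, hC₃, h₃⟩ := exists_levelConst_le hp hq hr
  refine ⟨C₁ + C₂ * C₃, ENNReal.add_ne_top.2 ⟨hC₁, ENNReal.mul_ne_top hC₂ hC₃⟩,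
    fun b hb k hkc hk β γ μ _ _ _ h => ?_⟩
  have := nonempty_J hb
  have hω := h.isWeight hp
  have hH := isHardyBound_coneNorm (q := q) (β := β) (γ := γ) (μ := μ) hkc hk hp hq hr
  set H := coneNorm p q r k β γ μ
  constructor
  · rw [constE_eq_embConst]
    refine (h₁ b _ _ _ hω H fun P hP hP1 => hH.lintegral_withDensity_le hp hq hr hP hP1).trans ?_
    gcongr
    exact le_self_add
  · rw [constF_eq_tailConst hp hr h]
    calc _ ≤ C₂ * (C₃ * H) := (h₂ b _ γ (initConst_mono hp hr _ _)
            (exists_lt_initConst hp hr _ _)).trans (by gcongr; exact h₃ b _ _ _ γ hω H hH)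
      _ = C₂ * C₃ * H := (mul_assoc _ _ _).symm
      _ ≤ _ := by
          gcongr
          exact le_add_self

end HardyCone

end

theorem theorem3p1 (p q r : ℝ) (hp : 0 < p) (hq : 0 < q) (hr : 0 < r) :
    (p ≤ min q r →
      ∀ (b : EReal) (_ : 0 < b) (k : HardyCone.J b → ℝ) (_ : Continuous k) (_ : ∀ t, 0 < k t)
        (β γ μ : MeasureTheory.Measure (HardyCone.J b))
        [MeasureTheory.NullSingletonClass β] [MeasureTheory.NullSingletonClass γ] [MeasureTheory.NullSingletonClass μ]
        (_ : HardyCone.MemN p k β),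
        HardyCone.coneNorm p q r k β γ μ = HardyCone.constJ p q r k β γ μ) ∧
    (min q r < p →
      ∃ c : NNReal, 1 ≤ c ∧
        ∀ (b : EReal) (_ : 0 < b) (k : HardyCone.J b → ℝ) (_ : Continuous k) (_ : ∀ t, 0 < k t)
          (β γ μ : MeasureTheory.Measure (HardyCone.J b))
          [MeasureTheory.NullSingletonClass β] [MeasureTheory.NullSingletonClass γ] [MeasureTheory.NullSingletonClass μ]
          (_ : HardyCone.MemN p k β),
          (c : ENNReal)⁻¹ *
              (HardyCone.constE p q r k β γ μ ^ r + HardyCone.constF p q r k β γ μ ^ r) ^ (1 / r)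
            ≤ HardyCone.coneNorm p q r k β γ μ ∧
          HardyCone.coneNorm p q r k β γ μ
            ≤ (c : ENNReal) *
              (HardyCone.constE p q r k β γ μ ^ r + HardyCone.constF p q r k β γ μ ^ r) ^ (1 / r)) := by
  refine ⟨fun hpqr b _ k hkc hk β γ μ _ _ _ h => le_antisymm
    (HardyCone.coneNorm_le_constJ hkc hk hp hq hr (hpqr.trans (min_le_left _ _))
      (hpqr.trans (min_le_right _ _)) h) (HardyCone.constJ_le_coneNorm hkc hk hp hr h), fun _ => ?_⟩
  obtain ⟨C₁, hC₁, h₁⟩ := HardyCone.exists_coneNorm_le hp hq hr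
  obtain ⟨C₂, hC₂, h₂⟩ := HardyCone.exists_le_coneNorm hp hq hr
  -- The factor `2^(1/r)` arises from `(x^r + x^r)^(1/r)` in the lower estimate; the summand `1`
  -- ensures that the constant is at least `1`.
  set C : ENNReal := C₁ + 2 ^ (1 / r) * C₂ + 1 with hC
  have hCt : C ≠ ∞ := by simp [hC, hC₁, hC₂, ENNReal.mul_ne_top]
  have hC0 : C ≠ 0 := by simp [hC]
  refine ⟨C.toNNReal, ?_, fun b hb k hkc hk β γ μ _ _ _ h => ?_⟩
  · rw [← ENNReal.coe_le_coe, ENNReal.coe_toNNReal hCt]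
    exact le_add_self
  rw [ENNReal.coe_toNNReal hCt]
  obtain ⟨hE, hF⟩ := h₂ b hb k hkc hk β γ μ h
  set E := HardyCone.constE p q r k β γ μ
  set F := HardyCone.constF p q r k β γ μ
  set H := HardyCone.coneNorm p q r k β γ μ
  constructor
  · have hX : (E ^ r + F ^ r) ^ (1 / r) ≤ C * H := by
      calc (E ^ r + F ^ r) ^ (1 / r) ≤ ((C₂ * H) ^ r + (C₂ * H) ^ r) ^ (1 / r) := by gcongr
        _ = 2 ^ (1 / r) * C₂ * H := by
            rw [← two_mul, ENNReal.mul_rpow_of_nonneg _ _ (by positivity),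
              HardyCone.rpow_rpow_one_div _ hr, mul_assoc]
        _ ≤ C * H := by
            gcongr
            rw [hC, add_right_comm]
            exact le_add_self
    calc C⁻¹ * (E ^ r + F ^ r) ^ (1 / r) ≤ C⁻¹ * (C * H) := by gcongr
      _ = H := by rw [← mul_assoc, ENNReal.inv_mul_cancel hC0 hCt, one_mul]
  · refine (h₁ b hb k hkc hk β γ μ h ((E ^ r + F ^ r) ^ (1 / r)) ?_ ?_).trans ?_
    · rw [one_div, ENNReal.le_rpow_inv_iff hr]; exact le_self_add
    · rw [one_div, ENNReal.le_rpow_inv_iff hr]; exact le_add_self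
    · gcongr
      rw [hC, add_assoc]
      exact le_self_add
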